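/- **Setting.** Let $d\ge 1$, $T\ge 1$, $S^d=\{c\in\mathbb R^d:\|c\|=1\}$. Put $\theta(c,v)$ for the angle between $c$ and $v$, with $\theta(0,v)=0$. For $C\subseteq\mathbb R^d$ the uncertainty angle is $\alpha(C)=\inf_{v\in S^d}\sup_{c\in C}\theta(c,v)$, and a circumcenter of $C$ is a $v\in S^d$ attaining it. An initial knowledge set $C_0\subseteq S^d$ is given and an unknown cost vector $c^\star\in C_0$ is fixed. In each period $t=1,\dots,T$ an adversary picks a nonempty feasible set $\mathcal X_t\subset\mathbb R^m$ of diameter at most $1$ and a context function $f_t$ into $\mathbb R^d$ that is $1$-Lipschitz on $\mathcal X_t$. Let $\psi(c,\mathcal X,f)=\arg\min_{x\in\mathcal X}f(x)'c$ (assumed attained where it is used). The decision-maker plays $x_t\in\mathcal X_t$ and then observes some $x_t^\star\in\psi(c^\star,\mathcal X_t,f_t)$. The cumulative regret is $\sum_{t=1}^T(f_t(x_t)-f_t(x_t^\star))'c^\star$. **Algorithm EllipsoidalCones with parameter $\varepsilon$.** For a diagonal $W\in\mathbb R^{(d-1)\times(d-1)}$ with nonnegative entries and an orthogonal $U\in\mathbb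 R^{d\times d}$ let $E(W,U)=\{Uy: y_{1}\ge 0,\ y_{[2:d]}'W^{-1}y_{[2:d]}\le y_{1}^2\}$ (a zero entry of $W$ forces the corresponding coordinate of $y$ to be $0$). Start with $W_1=\tan^2\alpha(C_0)\,I$ and an orthogonal $U_1$ such that $U_1e_1$ is a circumcenter of $C_0$. In period $t$ let $c_t$ be the circumcenter of $E(W_t,U_t)$ and play $x_t\in\psi(c_t,\mathcal X_t,f_t)$. Let $\delta_t=(f_t(x_t)-f_t(x_t^\star))/\|f_t(x_t)-f_t(x_t^\star)\|$ ($\delta_t=0$ if the denominator vanishes), $\bar\delta=U_t^{-1}\delta_t$ and $q=\bar\delta_{[2:d]}'W_t\bar\delta_{[2:d]}$. If $q\le\varepsilon^2$, keep $(W_{t+1},U_{t+1})=(W_t,U_t)$. If $q>\varepsilon^2$, set $$b=\frac{W_t\bar\delta_{[2:d]}}{\sqrt q},\quad a=\frac bd,\quad N=\frac{(d-1)^2}{(d-1)^2-1}\Bigl(W_t-\frac2d\,bb'\Bigr),\quad M=\begin{pmatrix}1&a'\\a&aa'-N\end{pmatrix},$$ with $N=W_t/4$ if $d=2$. Take an orthogonal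 diagonalization $M=V\Lambda V'$ with eigenvalues in nonincreasing order and $V_{11}>0$; set $U_{t+1}=U_tV$ and let $W_{t+1}$ be the diagonal matrix of the eigenvalues of $N$ in nondecreasing order. **Theorem.** Suppose $\alpha(C_0)<\pi/2$. 1. For every $c^\star\in C_0$, every sequence of feasible sets and context functions as above, and all choices of minimizers and diagonalizations, every run of EllipsoidalCones with $\varepsilon=d/T$ has cumulative regret at most $$2(d-1)^2\max\{0,\ln(10\,T\tan\alpha(C_0))\}+d,$$ where the first summand is $0$ if $\alpha(C_0)=0$. 2. EllipsoidalCones with $\varepsilon=d/T$ runs in time polynomial in $d$ and $T$. Precisely, in a real-number model of computation where each real or index operation, comparison, memory access and loop iteration costs a bounded number of steps, an orthogonal diagonalization of a symmetric $k\times k$ matrix costs $\kappa k^3+1$ steps, and each period has one call of the optimization oracle (announce $c_t$, receive $f_t(x_t)$ and $f_t(x_t^\star)$) at a cost of $3d+1$ steps, there is a single program, independent of $d$ and $T$, that receives $d$, $T$, the circumcenter of $C_0$ and $\tan\alpha(C_0)$ and whose every execution is a run of the algorithm. For every constant $\kappa$ there is a polynomial $P$ such that the total number of steps is at most $P(d,T)$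 in every instance. -/

import Mathlib

open scoped Matrix

noncomputable section

namespace ConeRegret

/-- The Euclidean space `ℝᵈ` with `d = n + 1`. Coordinate `0` is the first coordinate, the
coordinates `i.succ` with `i : Fin n` are the remaining `d - 1` ones. -/
abbrev Vec (n : ℕ) := EuclideanSpace ℝ (Fin (n + 1))

/-! ### Angles, uncertainty angle, circumcenter -/

/-- Angle between `c` and `v`, with the convention that the angle is `0` when `c = 0`. -/
def theta {n : ℕ} (c v : Vec n) : ℝ :=
  open Classical in if c = 0 then 0 else InnerProductGeometry.angle c v

/-- Uncertainty angle `α(C)`: the infimum over unit vectors `v` of the largest angle between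
`v` and an element of `C`. -/
def uncertaintyAngle {n : ℕ} (C : Set (Vec n)) : ℝ :=
  ⨅ v : Metric.sphere (0 : Vec n) 1, ⨆ c : C, theta (c : Vec n) v

/-- `v` is a circumcenter of `C`: a unit vector attaining the uncertainty angle. -/
def IsCircumcenter {n : ℕ} (C : Set (Vec n)) (v : Vec n) : Prop :=
  ‖v‖ = 1 ∧ ⨆ c : C, theta (c : Vec n) v = uncertaintyAngle C

/-! ### Forward problems and regret -/

/-- `ψ(c, X, f)`: the minimizers of `x ↦ f(x)'c` over `X`. -/
def argmins {n m : ℕ} (c : Vec n) (X : Set (EuclideanSpace ℝ (Fin m)))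
    (f : EuclideanSpace ℝ (Fin m) → Vec n) : Set (EuclideanSpace ℝ (Fin m)) :=
  {x | x ∈ X ∧ ∀ y ∈ X, inner ℝ (f x) c ≤ inner ℝ (f y) c}

/-- A sequence of feasible sets of diameter at most one and of context functions that are
`1`-Lipschitz on them, for the periods `0, …, T - 1`. -/
def Admissible {n m : ℕ} (T : ℕ) (X : ℕ → Set (EuclideanSpace ℝ (Fin m)))
    (f : ℕ → EuclideanSpace ℝ (Fin m) → Vec n) : Prop :=
  ∀ t < T, (X t).Nonempty ∧ (∀ x ∈ X t, ∀ y ∈ X t, dist x y ≤ 1) ∧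
    LipschitzOnWith 1 (f t) (X t)

/-- Cumulative regret `∑ₜ (fₜ(xₜ) - fₜ(xₜ⋆))'c⋆`. -/
def regret {n m : ℕ} (T : ℕ) (cstar : Vec n) (f : ℕ → EuclideanSpace ℝ (Fin m) → Vec n)
    (x xstar : ℕ → EuclideanSpace ℝ (Fin m)) : ℝ :=
  ∑ t ∈ Finset.range T, inner ℝ (f t (x t) - f t (xstar t)) cstar

/-- The effective difference: `f(x) - f(x⋆)` normalized, and `0` if it vanishes. -/
def effectiveDiff {n m : ℕ} (f : EuclideanSpace ℝ (Fin m) → Vec n)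
    (x xstar : EuclideanSpace ℝ (Fin m)) : Vec n :=
  ‖f x - f xstar‖⁻¹ • (f x - f xstar)

/-! ### Ellipsoidal cones and their update -/

/-- Coordinates `U⁻¹ c` of `c` in the orthonormal basis given by the columns of `U`. -/
def coords {n : ℕ} (U : Matrix (Fin (n + 1)) (Fin (n + 1)) ℝ) (c : Vec n) : Fin (n + 1) → ℝ :=
  Uᵀ *ᵥ WithLp.ofLp c

/-- The ellipsoidal cone `E(W, U)` for `W = diagonal w`: the vectors `c = U y` with `y₁ ≥ 0` and
`y_[2:d]' W⁻¹ y_[2:d] ≤ y₁²`. A vanishing diagonal entry of `W` forces the corresponding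
coordinate of `y` to vanish. -/
def ellipsoidalCone {n : ℕ} (w : Fin n → ℝ) (U : Matrix (Fin (n + 1)) (Fin (n + 1)) ℝ) :
    Set (Vec n) :=
  {c | 0 ≤ coords U c 0 ∧ (∀ i, w i = 0 → coords U c i.succ = 0) ∧
    ∑ i, coords U c i.succ ^ 2 / w i ≤ coords U c 0 ^ 2}

/-- The squared width `δ̄_[2:d]' W δ̄_[2:d]`, where `δ̄ = U⁻¹ δ` and `W = diagonal w`. -/
def width {n : ℕ} (w : Fin n → ℝ) (U : Matrix (Fin (n + 1)) (Fin (n + 1)) ℝ) (δ : Vec n) : ℝ :=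
  (fun i : Fin n => coords U δ i.succ) ⬝ᵥ
    (Matrix.diagonal w *ᵥ fun i : Fin n => coords U δ i.succ)

/-- `A = V Λ V'` with `V` orthogonal and `Λ = diagonal l`; the columns of `V` are eigenvectors. -/
def IsSpectralDecomposition {ι : Type} [Fintype ι] [DecidableEq ι] (A : Matrix ι ι ℝ)
    (l : ι → ℝ) (V : Matrix ι ι ℝ) : Prop :=
  V ∈ Matrix.orthogonalGroup ι ℝ ∧ A = V * Matrix.diagonal l * Vᵀ

/-- `b = W δ̄_[2:d] / √(δ̄_[2:d]' W δ̄_[2:d])`. -/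
def updB {n : ℕ} (w : Fin n → ℝ) (U : Matrix (Fin (n + 1)) (Fin (n + 1)) ℝ) (δ : Vec n) :
    Fin n → ℝ :=
  (Real.sqrt (width w U δ))⁻¹ • (Matrix.diagonal w *ᵥ fun i : Fin n => coords U δ i.succ)

/-- `a = b / d`. -/
def updA {n : ℕ} (w : Fin n → ℝ) (U : Matrix (Fin (n + 1)) (Fin (n + 1)) ℝ) (δ : Vec n) :
    Fin n → ℝ :=
  ((n : ℝ) + 1)⁻¹ • updB w U δ

/-- `N = (d-1)² / ((d-1)² - 1) (W - (2/d) b b')`. For `d = 2` this reads `(1/0) * 0`; there it is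
replaced by `W / 4`, the smallest one-dimensional ellipsoid (interval) containing
half of the given one. -/
def updN {n : ℕ} (w : Fin n → ℝ) (U : Matrix (Fin (n + 1)) (Fin (n + 1)) ℝ) (δ : Vec n) :
    Matrix (Fin n) (Fin n) ℝ :=
  if n = 1 then (1 / 4 : ℝ) • Matrix.diagonal w
  else ((n : ℝ) ^ 2 / ((n : ℝ) ^ 2 - 1)) •
    (Matrix.diagonal w - (2 / ((n : ℝ) + 1)) • Matrix.vecMulVec (updB w U δ) (updB w U δ))

/-- The block matrix `M` with rows `(1, a')` and `(a, a a' - N)`. -/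
def updM {n : ℕ} (w : Fin n → ℝ) (U : Matrix (Fin (n + 1)) (Fin (n + 1)) ℝ) (δ : Vec n) :
    Matrix (Fin (n + 1)) (Fin (n + 1)) ℝ :=
  Matrix.of <| Fin.cases
    (Fin.cases 1 fun j => updA w U δ j)
    (fun i => Fin.cases (updA w U δ i)
      fun j => updA w U δ i * updA w U δ j - updN w U δ i j)

/-- `(w', U')` is an output of the cone update on `(w, U)` with the cut `δ`: `U' = U V` for a
spectral decomposition `M = V Λ V'` with the eigenvalues in nonincreasing order and the first
column of `V` oriented so that its first entry is positive, and `w'` lists the eigenvalues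
of `N` in nondecreasing order. -/
def ConeUpdate {n : ℕ} (w : Fin n → ℝ) (U : Matrix (Fin (n + 1)) (Fin (n + 1)) ℝ) (δ : Vec n)
    (w' : Fin n → ℝ) (U' : Matrix (Fin (n + 1)) (Fin (n + 1)) ℝ) : Prop :=
  (Monotone w' ∧ ∃ Q, IsSpectralDecomposition (updN w U δ) w' Q) ∧
  ∃ (l : Fin (n + 1) → ℝ) (V : Matrix (Fin (n + 1)) (Fin (n + 1)) ℝ),
    Antitone l ∧ IsSpectralDecomposition (updM w U δ) l V ∧ 0 < V 0 0 ∧ U' = U * V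

/-- The sequences `c` (proxy costs), `x` (actions), `w`, `U` (cones) form a run of the algorithm
`EllipsoidalCones` with parameter `ε` and initial knowledge set `C₀` over periods `0, …, T - 1`,
when the feasible sets, context functions and observed optimal actions are `X`, `f`, `xstar`. -/
structure IsRun {n m : ℕ} (ε : ℝ) (C₀ : Set (Vec n)) (T : ℕ)
    (X : ℕ → Set (EuclideanSpace ℝ (Fin m))) (f : ℕ → EuclideanSpace ℝ (Fin m) → Vec n)
    (xstar x : ℕ → EuclideanSpace ℝ (Fin m)) (c : ℕ → Vec n) (w : ℕ → Fin n → ℝ)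
    (U : ℕ → Matrix (Fin (n + 1)) (Fin (n + 1)) ℝ) : Prop where
  start_orthogonal : U 0 ∈ Matrix.orthogonalGroup (Fin (n + 1)) ℝ
  start_axis : IsCircumcenter C₀ (WithLp.toLp 2 fun i => U 0 i 0)
  start_width : ∀ i, w 0 i = Real.tan (uncertaintyAngle C₀) ^ 2
  proxy : ∀ t < T, IsCircumcenter (ellipsoidalCone (w t) (U t)) (c t)
  action : ∀ t < T, x t ∈ argmins (c t) (X t) (f t)
  cone_update : ∀ t < T, ε ^ 2 < width (w t) (U t) (effectiveDiff (f t) (x t) (xstar t)) →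
    ConeUpdate (w t) (U t) (effectiveDiff (f t) (x t) (xstar t)) (w (t + 1)) (U (t + 1))
  no_update : ∀ t < T, width (w t) (U t) (effectiveDiff (f t) (x t) (xstar t)) ≤ ε ^ 2 →
    w (t + 1) = w t ∧ U (t + 1) = U t

/-! ### A uniform programming language over the reals, with a step count

Memory consists of two-dimensional real arrays, numbered by `ℕ`, and of natural-number index
variables, numbered by `ℕ`. Every arithmetic operation, comparison, memory access and loop
iteration is counted. -/

/-- Index expressions. -/
inductive IExpr where
  | lit (k : ℕ)
  | var (v : ℕ)
  | plus (i j : IExpr)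
  | minus (i j : IExpr)

/-- Value of an index expression (subtraction is truncated). -/
def IExpr.eval (ix : ℕ → ℕ) : IExpr → ℕ
  | .lit k => k
  | .var v => ix v
  | .plus i j => i.eval ix + j.eval ix
  | .minus i j => i.eval ix - j.eval ix

/-- Number of steps to evaluate an index expression. -/
def IExpr.steps : IExpr → ℕ
  | .lit _ => 1
  | .var _ => 1
  | .plus i j => i.steps + j.steps + 1
  | .minus i j => i.steps + j.steps + 1

/-- Real expressions: array access, indices as reals, arithmetic, square roots, a sum of `e` over
`v = 0, …, k - 1`, and `if p ≤ q then r else s`. -/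
inductive RExpr where
  | get (a : ℕ) (i j : IExpr)
  | cast (i : IExpr)
  | plus (p q : RExpr)
  | minus (p q : RExpr)
  | times (p q : RExpr)
  | over (p q : RExpr)
  | root (p : RExpr)
  | sum (v : ℕ) (k : IExpr) (e : RExpr)
  | cond (p q r s : RExpr)

/-- Value of a real expression. -/
def RExpr.eval (mem : ℕ → ℕ → ℕ → ℝ) : (ℕ → ℕ) → RExpr → ℝ
  | ix, .get a i j => mem a (i.eval ix) (j.eval ix)
  | ix, .cast i => (i.eval ix : ℝ)
  | ix, .plus p q => p.eval mem ix + q.eval mem ix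
  | ix, .minus p q => p.eval mem ix - q.eval mem ix
  | ix, .times p q => p.eval mem ix * q.eval mem ix
  | ix, .over p q => p.eval mem ix / q.eval mem ix
  | ix, .root p => Real.sqrt (p.eval mem ix)
  | ix, .sum v k e => ∑ r ∈ Finset.range (k.eval ix), e.eval mem (Function.update ix v r)
  | ix, .cond p q r s => if p.eval mem ix ≤ q.eval mem ix then r.eval mem ix else s.eval mem ix

/-- Number of steps to evaluate a real expression. -/
def RExpr.steps (mem : ℕ → ℕ → ℕ → ℝ) : (ℕ → ℕ) → RExpr → ℕ
  | _, .get _ i j => i.steps + j.steps + 1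
  | _, .cast i => i.steps + 1
  | ix, .plus p q => p.steps mem ix + q.steps mem ix + 1
  | ix, .minus p q => p.steps mem ix + q.steps mem ix + 1
  | ix, .times p q => p.steps mem ix + q.steps mem ix + 1
  | ix, .over p q => p.steps mem ix + q.steps mem ix + 1
  | ix, .root p => p.steps mem ix + 1
  | ix, .sum v k e => k.steps + 1 +
      ∑ r ∈ Finset.range (k.eval ix), (e.steps mem (Function.update ix v r) + 2)
  | ix, .cond p q r s => p.steps mem ix + q.steps mem ix + 1 +
      if p.eval mem ix ≤ q.eval mem ix then r.steps mem ix else s.steps mem ix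

/-- Commands: no operation; `a[u][v] := e` for all `u < k`, `v < l` (all right-hand sides are
evaluated before any entry is written); sequencing; branching on `p ≤ q`; a loop over
`v = 0, …, k - 1`; and the spectral decomposition of the `k × k` block of array `a`, which
writes the eigenvalues to column `0` of array `l` and the eigenvectors to the columns of
array `q`. -/
inductive Cmd where
  | skip
  | fill (a u v : ℕ) (k l : IExpr) (e : RExpr)
  | seq (p q : Cmd)
  | cond (p q : RExpr) (r s : Cmd)
  | loop (v : ℕ) (k : IExpr) (p : Cmd)
  | eig (a : ℕ) (k : IExpr) (l q : ℕ)

/-- A state of the machine, together with the number of steps made so far. -/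
structure State where
  mem : ℕ → ℕ → ℕ → ℝ
  ix : ℕ → ℕ
  steps : ℕ

/-- Overwrite the `k × l` block of array `a` with the values `g`. -/
def setBlock (mem : ℕ → ℕ → ℕ → ℝ) (a k l : ℕ) (g : ℕ → ℕ → ℝ) : ℕ → ℕ → ℕ → ℝ :=
  Function.update mem a fun i j => if i < k ∧ j < l then g i j else mem a i j

/-- A spectral decomposition routine: eigenvalues and eigenvector matrix for each size. -/
abbrev Solver := (k : ℕ) → Matrix (Fin k) (Fin k) ℝ → (Fin k → ℝ) × Matrix (Fin k) (Fin k) ℝ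

/-- On symmetric matrices, the routine returns a spectral decomposition with the eigenvalues in
nonincreasing order. -/
def Solver.Correct (S : Solver) : Prop :=
  ∀ (k : ℕ) (A : Matrix (Fin k) (Fin k) ℝ), A.IsSymm →
    Antitone (S k A).1 ∧ IsSpectralDecomposition A (S k A).1 (S k A).2

/-- Execution of a command. A spectral decomposition of size `k` is charged `κ k³ + 1` steps on
top of the evaluation of `k`; all other costs are unit costs. -/
def Cmd.exec (S : Solver) (κ : ℕ) : Cmd → State → State
  | .skip, s => s
  | .fill a u v k l e, s =>
      { mem := setBlock s.mem a (k.eval s.ix) (l.eval s.ix) fun i j =>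
          e.eval s.mem (Function.update (Function.update s.ix u i) v j)
        ix := s.ix
        steps := s.steps + k.steps + l.steps + 1 +
          ∑ i ∈ Finset.range (k.eval s.ix), (1 + ∑ j ∈ Finset.range (l.eval s.ix),
            (e.steps s.mem (Function.update (Function.update s.ix u i) v j) + 2)) }
  | .seq p q, s => q.exec S κ (p.exec S κ s)
  | .cond p q r t, s =>
      let s' : State :=
        { mem := s.mem, ix := s.ix
          steps := s.steps + p.steps s.mem s.ix + q.steps s.mem s.ix + 1 }
      if p.eval s.mem s.ix ≤ q.eval s.mem s.ix then r.exec S κ s' else t.exec S κ s'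
  | .loop v k p, s =>
      (List.range (k.eval s.ix)).foldl
        (fun s' r => p.exec S κ
          { mem := s'.mem, ix := Function.update s'.ix v r, steps := s'.steps + 1 })
        { mem := s.mem, ix := s.ix, steps := s.steps + k.steps + 1 }
  | .eig a k l q, s =>
      let N := k.eval s.ix
      let D := S N (Matrix.of fun i j => s.mem a i j)
      { mem := setBlock
          (setBlock s.mem l N 1 fun i _ => if h : i < N then D.1 ⟨i, h⟩ else 0) q N N
          fun i j => if h : i < N ∧ j < N then D.2 ⟨i, h.1⟩ ⟨j, h.2⟩ else 0
        ix := s.ix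
        steps := s.steps + k.steps + κ * N ^ 3 + 1 }

/-- An online program: one command run before the first period, and one run at the end of every
period. Neither depends on the dimension, the horizon or any real constant. -/
structure OnlineProgram where
  start : Cmd
  step : Cmd

/-- The state before the program starts: index variables `0` and `1` hold `d = n + 1` and `T`, the
vector `c₀` is in array `0`, the number `τ` is in array `1`, and everything else is zero. -/
def inputState (n T : ℕ) (c₀ : Vec n) (τ : ℝ) : State where
  mem := fun a i j =>
    if a = 0 ∧ j = 0 then (if h : i < n + 1 then c₀ ⟨i, h⟩ else 0)
    else if a = 1 ∧ i = 0 ∧ j = 0 then τ else 0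
  ix := fun v => if v = 0 then n + 1 else if v = 1 then T else 0
  steps := 0

/-- The proxy cost vector announced by the program, read off array `2`. -/
def State.proxy (n : ℕ) (s : State) : Vec n :=
  WithLp.toLp 2 fun i => s.mem 2 i 0

/-- Write the vectors `g` and `h` into arrays `3` and `4`. The announcement of the proxy cost,
the call of the optimization oracle and the transfer of the answers cost `3 d + 1` steps. -/
def State.receive {n : ℕ} (s : State) (g h : Vec n) : State where
  mem := setBlock
    (setBlock s.mem 3 (n + 1) 1 fun i _ => if hi : i < n + 1 then g ⟨i, hi⟩ else 0) 4 (n + 1) 1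
    fun i _ => if hi : i < n + 1 then h ⟨i, hi⟩ else 0
  ix := s.ix
  steps := s.steps + 3 * (n + 1) + 1

/-- The state of the online program after `t` periods, when the vectors received in period `r`
are `g r` and `h r`. -/
def OnlineProgram.run (p : OnlineProgram) (S : Solver) (κ : ℕ) {n : ℕ} (T : ℕ) (c₀ : Vec n)
    (τ : ℝ) (g h : ℕ → Vec n) : ℕ → State
  | 0 => p.start.exec S κ (inputState n T c₀ τ)
  | t + 1 => p.step.exec S κ ((p.run S κ T c₀ τ g h t).receive (g t) (h t))

end ConeRegret

end

/-!
In the frame `U`, write `c⋆` as `(y, z)`. That `c⋆` lies in the cone means `z' W⁻¹ z ≤ y²`. The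
played vector is the axis of the cone, so optimality of `x_t` and of `x_t⋆` makes `δ_t` a cut
through the center of this ellipsoid: `b' W⁻¹ z ≥ 0`. The half ellipsoid lies in the ellipsoid of
the matrix `N` around `y b / d`, and `M` is the quadratic form that turns this translated ellipsoid
back into an ellipsoidal cone. It has one eigenvalue `≥ 1`, and by interlacing with `-N` its other
eigenvalues are nonpositive and at least the corresponding ones of `-N`; so `c⋆` stays in the cone
with axis the leading eigenvector of `M` and squared widths the eigenvalues of `N`.

An update divides `det W` by at least `exp (1 / (d - 1))`. It takes place only if the width in the
direction of the cut exceeds `ε`, which keeps all eigenvalues of `W` above `ε² / (4 (d - 1)²)`.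
Hence there are at most `2 (d - 1)² ln (2 (d - 1) tan α(C₀) / ε)` updates. Each of them costs regret
at most `1`, and every other period at most `ε`.

The program has one branch and no loops besides block fills and sums over ranges of length at most
`d`, so a polynomial bounding the number of its steps can be read off its commands.
-/

noncomputable section

namespace ConeRegret

/-! ### Spectral decompositions -/

section Orthogonal

variable {ι : Type*} [Fintype ι] [DecidableEq ι] {V : Matrix ι ι ℝ}

lemma transpose_mul_self_of_orthogonal (hV : V ∈ Matrix.orthogonalGroup ι ℝ) : Vᵀ * V = 1 :=
  (Matrix.mem_orthogonalGroup_iff' ι ℝ).1 hV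

lemma self_mul_transpose_of_orthogonal (hV : V ∈ Matrix.orthogonalGroup ι ℝ) : V * Vᵀ = 1 :=
  (Matrix.mem_orthogonalGroup_iff ι ℝ).1 hV

lemma transpose_mulVec_mulVec (hV : V ∈ Matrix.orthogonalGroup ι ℝ) (u : ι → ℝ) :
    Vᵀ *ᵥ (V *ᵥ u) = u := by
  rw [Matrix.mulVec_mulVec, transpose_mul_self_of_orthogonal hV, Matrix.one_mulVec]

lemma mulVec_transpose_mulVec (hV : V ∈ Matrix.orthogonalGroup ι ℝ) (u : ι → ℝ) :
    V *ᵥ (Vᵀ *ᵥ u) = u := by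
  rw [Matrix.mulVec_mulVec, self_mul_transpose_of_orthogonal hV, Matrix.one_mulVec]

lemma dotProduct_transpose_mulVec (hV : V ∈ Matrix.orthogonalGroup ι ℝ) (u v : ι → ℝ) :
    (Vᵀ *ᵥ u) ⬝ᵥ (Vᵀ *ᵥ v) = u ⬝ᵥ v := by
  rw [Matrix.dotProduct_mulVec, Matrix.vecMul_transpose, mulVec_transpose_mulVec hV]

lemma dotProduct_col_self (hV : V ∈ Matrix.orthogonalGroup ι ℝ) (k : ι) :
    V.col k ⬝ᵥ V.col k = 1 := by
  rw [← dotProduct_transpose_mulVec hV, ← Matrix.mulVec_single_one, transpose_mulVec_mulVec hV,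
    dotProduct_single, Pi.single_eq_same, mul_one]

end Orthogonal

lemma dotProduct_mulVec_nonneg {ι : Type*} [Fintype ι] {A : Matrix ι ι ℝ} (hA : A.PosSemidef)
    (u : ι → ℝ) : 0 ≤ u ⬝ᵥ A *ᵥ u := by
  simpa only [star_trivial] using hA.dotProduct_mulVec_nonneg u

lemma sq_dotProduct_mulVec_le {ι : Type*} [Fintype ι] {A : Matrix ι ι ℝ} (hA : A.PosSemidef)
    (u v : ι → ℝ) : (u ⬝ᵥ A *ᵥ v) ^ 2 ≤ (u ⬝ᵥ A *ᵥ u) * (v ⬝ᵥ A *ᵥ v) := by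
  classical
  have hsymm : LinearMap.IsSymm (Matrix.toBilin' A) := ⟨fun x y => by
    rw [RingHom.id_apply, Matrix.toBilin'_apply', Matrix.toBilin'_apply', Matrix.dotProduct_mulVec,
      dotProduct_comm, ← Matrix.mulVec_transpose, ← A.conjTranspose_eq_transpose_of_trivial,
      hA.isHermitian.eq]⟩
  simpa only [Matrix.toBilin'_apply'] using
    (Matrix.toBilin' A).apply_sq_le_of_symm
      (fun x => by rw [Matrix.toBilin'_apply']; exact dotProduct_mulVec_nonneg hA x) hsymm u v

namespace IsSpectralDecomposition

variable {ι : Type} [Fintype ι] [DecidableEq ι] {A V : Matrix ι ι ℝ} {l : ι → ℝ}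

lemma transpose_mulVec (h : IsSpectralDecomposition A l V) (u : ι → ℝ) (i : ι) :
    (Vᵀ *ᵥ (A *ᵥ u)) i = l i * (Vᵀ *ᵥ u) i := by
  rw [h.2, ← Matrix.mulVec_mulVec, ← Matrix.mulVec_mulVec, transpose_mulVec_mulVec h.1,
    Matrix.mulVec_diagonal]

lemma mulVec_col (h : IsSpectralDecomposition A l V) (k : ι) :
    A *ᵥ V.col k = l k • V.col k := by
  rw [← Matrix.mulVec_single_one, h.2, ← Matrix.mulVec_mulVec, transpose_mulVec_mulVec h.1,
    ← Matrix.mulVec_mulVec, Matrix.diagonal_mulVec_single, ← Matrix.mulVec_smul, ← Pi.single_smul',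
    smul_eq_mul]

lemma dotProduct_mulVec (h : IsSpectralDecomposition A l V) (u v : ι → ℝ) :
    u ⬝ᵥ A *ᵥ v = ∑ i, l i * ((Vᵀ *ᵥ u) i * (Vᵀ *ᵥ v) i) := by
  rw [← dotProduct_transpose_mulVec h.1]
  simp only [dotProduct, h.transpose_mulVec]
  exact Finset.sum_congr rfl fun i _ => by ring

lemma dotProduct_mulVec_col (h : IsSpectralDecomposition A l V) (k : ι) :
    V.col k ⬝ᵥ A *ᵥ V.col k = l k := by
  rw [h.mulVec_col, dotProduct_smul, dotProduct_col_self h.1, smul_eq_mul, mul_one]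

lemma dotProduct_mulVec_le (h : IsSpectralDecomposition A l V) {c : ℝ} {u : ι → ℝ}
    (hu : ∀ k, c < l k → (Vᵀ *ᵥ u) k = 0) : u ⬝ᵥ A *ᵥ u ≤ c * (u ⬝ᵥ u) := by
  rw [h.dotProduct_mulVec, ← dotProduct_transpose_mulVec h.1 u u, dotProduct, Finset.mul_sum]
  refine Finset.sum_le_sum fun k _ => ?_
  rcases le_or_gt (l k) c with hk | hk
  · exact mul_le_mul_of_nonneg_right hk (mul_self_nonneg _)
  · simp only [hu k hk, mul_zero, le_refl]

lemma nonneg (h : IsSpectralDecomposition A l V) (hA : A.PosSemidef) (k : ι) : 0 ≤ l k := by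
  rw [← h.dotProduct_mulVec_col k]
  exact dotProduct_mulVec_nonneg hA _

lemma le_eigenvalue (h : IsSpectralDecomposition A l V) {c : ℝ}
    (hc : ∀ u, c * (u ⬝ᵥ u) ≤ u ⬝ᵥ A *ᵥ u) (k : ι) : c ≤ l k := by
  simpa only [h.dotProduct_mulVec_col, dotProduct_col_self h.1, mul_one] using hc (V.col k)

lemma det_eq (h : IsSpectralDecomposition A l V) : A.det = ∏ i, l i := by
  have hV : V.det * Vᵀ.det = 1 := by
    rw [← Matrix.det_mul, self_mul_transpose_of_orthogonal h.1, Matrix.det_one]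
  rw [h.2, Matrix.det_mul, Matrix.det_mul, mul_right_comm, hV, one_mul, Matrix.det_diagonal]

lemma neg (h : IsSpectralDecomposition A l V) : IsSpectralDecomposition A l (-V) := by
  refine ⟨?_, by rw [h.2, Matrix.transpose_neg, Matrix.mul_neg, Matrix.neg_mul, Matrix.neg_mul,
    neg_neg]⟩
  rw [Matrix.mem_orthogonalGroup_iff]
  simpa using self_mul_transpose_of_orthogonal h.1

end IsSpectralDecomposition

/-! ### The block matrix `M` -/

/-- The block matrix with rows `(1, a')` and `(a, a a' - N)`, in which the cone update places the
shift `a` and the matrix `N` of the next ellipsoid. Its quadratic form is the square of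
`u ↦ u₁ + a' u_[2:d]` minus the form of `N`. -/
def blockMatrix {n : ℕ} (a : Fin n → ℝ) (N : Matrix (Fin n) (Fin n) ℝ) :
    Matrix (Fin (n + 1)) (Fin (n + 1)) ℝ :=
  Matrix.of <| Fin.cases (Fin.cases 1 fun j => a j)
    (fun i => Fin.cases (a i) fun j => a i * a j - N i j)

lemma updM_eq_blockMatrix {n : ℕ} (w : Fin n → ℝ) (U : Matrix (Fin (n + 1)) (Fin (n + 1)) ℝ)
    (δ : Vec n) : updM w U δ = blockMatrix (updA w U δ) (updN w U δ) := rfl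

lemma dotProduct_eq_zero_add_tail {n : ℕ} (u v : Fin (n + 1) → ℝ) :
    u ⬝ᵥ v = u 0 * v 0 + Fin.tail u ⬝ᵥ Fin.tail v :=
  Fin.sum_univ_succ _

section Block

variable {n : ℕ} {a : Fin n → ℝ} {N : Matrix (Fin n) (Fin n) ℝ}

lemma blockMatrix_mulVec (u : Fin (n + 1) → ℝ) :
    blockMatrix a N *ᵥ u = Fin.cons (u 0 + a ⬝ᵥ Fin.tail u)
      ((u 0 + a ⬝ᵥ Fin.tail u) • a - N *ᵥ Fin.tail u) := by
  refine funext <| Fin.cases ?_ fun i => ?_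
  · rw [Fin.cons_zero, Matrix.mulVec, dotProduct_eq_zero_add_tail]
    exact congrArg (· + _) (one_mul (u 0))
  · have hrow : Fin.tail (blockMatrix a N i.succ) = a i • a - N i := rfl
    rw [Fin.cons_succ, Matrix.mulVec, dotProduct_eq_zero_add_tail, hrow, sub_dotProduct,
      smul_dotProduct, Pi.sub_apply, Pi.smul_apply, smul_eq_mul, smul_eq_mul, Matrix.mulVec]
    change a i * u 0 + _ = _
    ring

lemma blockMatrix_mulVec_zero (u : Fin (n + 1) → ℝ) :
    (blockMatrix a N *ᵥ u) 0 = u 0 + a ⬝ᵥ Fin.tail u := by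
  rw [blockMatrix_mulVec, Fin.cons_zero]

lemma blockMatrix_mulVec_cons {v : Fin (n + 1) → ℝ} {r : Fin n → ℝ}
    (hr : N *ᵥ r = v 0 • a - Fin.tail v) :
    blockMatrix a N *ᵥ (Fin.cons (v 0 - a ⬝ᵥ r) r : Fin (n + 1) → ℝ) = v := by
  rw [blockMatrix_mulVec, Fin.tail_cons, Fin.cons_zero, sub_add_cancel, hr, sub_sub_cancel,
    Fin.cons_self_tail]

lemma dotProduct_blockMatrix_mulVec (u v : Fin (n + 1) → ℝ) :
    u ⬝ᵥ blockMatrix a N *ᵥ v =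
      (blockMatrix a N *ᵥ u) 0 * (blockMatrix a N *ᵥ v) 0 - Fin.tail u ⬝ᵥ N *ᵥ Fin.tail v := by
  rw [dotProduct_eq_zero_add_tail, blockMatrix_mulVec_zero, blockMatrix_mulVec_zero,
    blockMatrix_mulVec, Fin.tail_cons, dotProduct_sub, dotProduct_smul,
    dotProduct_comm _ a, smul_eq_mul]
  ring

variable {l : Fin (n + 1) → ℝ} {V : Matrix (Fin (n + 1)) (Fin (n + 1)) ℝ}

lemma one_le_eigenvalue_zero (hM : IsSpectralDecomposition (blockMatrix a N) l V)
    (hl : Antitone l) : 1 ≤ l 0 := by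
  have htail : Fin.tail (Pi.single 0 1 : Fin (n + 1) → ℝ) = 0 :=
    funext fun i => Pi.single_eq_of_ne (Fin.succ_ne_zero i) _
  have h := hM.dotProduct_mulVec_le (c := l 0) (u := Pi.single 0 1)
    fun k hk => absurd (hl (Fin.zero_le k)) hk.not_ge
  simpa only [dotProduct_blockMatrix_mulVec, blockMatrix_mulVec_zero, htail, dotProduct_zero,
    zero_dotProduct, Pi.single_eq_same, add_zero, mul_one, sub_zero, dotProduct_single] using h

lemma tail_col_dotProduct_mulVec (hM : IsSpectralDecomposition (blockMatrix a N) l V)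
    (k : Fin (n + 1)) :
    Fin.tail (V.col k) ⬝ᵥ N *ᵥ Fin.tail (V.col k) = (l k * V 0 k) ^ 2 - l k := by
  have h := hM.dotProduct_mulVec_col k
  rw [dotProduct_blockMatrix_mulVec, hM.mulVec_col] at h
  simp only [Pi.smul_apply, Matrix.col_apply, smul_eq_mul] at h
  linarith

lemma eigenvalue_zero_le_sq (hM : IsSpectralDecomposition (blockMatrix a N) l V)
    (hN : N.PosSemidef) : l 0 ≤ (l 0 * V 0 0) ^ 2 := by
  linarith [tail_col_dotProduct_mulVec hM 0, dotProduct_mulVec_nonneg hN (Fin.tail (V.col 0))]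

lemma eigenvector_zero_ne_zero (hM : IsSpectralDecomposition (blockMatrix a N) l V)
    (hl : Antitone l) (hN : N.PosSemidef) : V 0 0 ≠ 0 := by
  intro h
  have := eigenvalue_zero_le_sq hM hN
  rw [h, mul_zero] at this
  linarith [one_le_eigenvalue_zero hM hl]

lemma eigenvalue_succ_nonpos (hM : IsSpectralDecomposition (blockMatrix a N) l V)
    (hl : Antitone l) (hN : N.PosSemidef) (i : Fin n) : l i.succ ≤ 0 := by
  -- Two eigenvectors are orthogonal for the form of `M`, so that Cauchy-Schwarz for `N` on their
  -- tails forbids two positive eigenvalues.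
  set p := V.col 0
  set q := V.col i.succ
  have horth : Fin.tail p ⬝ᵥ N *ᵥ Fin.tail q = l 0 * V 0 0 * (l i.succ * V 0 i.succ) := by
    have hzero : p ⬝ᵥ blockMatrix a N *ᵥ q = 0 := by
      rw [hM.mulVec_col, dotProduct_smul]
      have := congrFun (congrFun (transpose_mul_self_of_orthogonal hM.1) 0) i.succ
      rw [Matrix.one_apply_ne (Fin.succ_ne_zero i).symm] at this
      exact (congrArg _ this).trans (smul_zero _)
    rw [dotProduct_blockMatrix_mulVec, hM.mulVec_col, hM.mulVec_col] at hzero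
    simpa only [Pi.smul_apply, smul_eq_mul, Matrix.col_apply] using (sub_eq_zero.1 hzero).symm
  have hcs := sq_dotProduct_mulVec_le hN (Fin.tail p) (Fin.tail q)
  rw [horth, tail_col_dotProduct_mulVec hM, tail_col_dotProduct_mulVec hM] at hcs
  have hA := eigenvalue_zero_le_sq hM hN
  have hB := dotProduct_mulVec_nonneg hN (Fin.tail q)
  rw [tail_col_dotProduct_mulVec hM] at hB
  have h1 := one_le_eigenvalue_zero hM hl
  by_contra! hpos
  nlinarith

/-- Dimension count behind the interlacing inequality: `i + 1` conditions on `u` and `n - (i + 1)`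
conditions on its tail leave a nonzero vector in dimension `n + 1`. -/
lemma exists_ne_zero_eigencoordinates_eq_zero (V : Matrix (Fin (n + 1)) (Fin (n + 1)) ℝ)
    (Q : Matrix (Fin n) (Fin n) ℝ) (i : Fin n) :
    ∃ u : Fin (n + 1) → ℝ, u ≠ 0 ∧ (∀ j ≤ i, (Vᵀ *ᵥ u) j.castSucc = 0) ∧
      ∀ j, i < j → (Qᵀ *ᵥ Fin.tail u) j = 0 := by
  let B : Matrix (Fin n) (Fin (n + 1)) ℝ := Matrix.of fun j =>
    if j ≤ i then V.col j.castSucc else Fin.cons 0 (Q.col j)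
  obtain ⟨u, hu, hu0⟩ := (Submodule.ne_bot_iff _).1
    (LinearMap.ker_ne_bot_of_finrank_lt (f := B.mulVecLin) (by simp))
  have hB (j : Fin n) :
      (if j ≤ i then V.col j.castSucc else Fin.cons 0 (Q.col j)) ⬝ᵥ u = 0 :=
    congrFun (LinearMap.mem_ker.1 hu) j
  refine ⟨u, hu0, fun j hj => ?_, fun j hj => ?_⟩
  · have := hB j
    rwa [if_pos hj] at this
  · have := hB j
    rwa [if_neg hj.not_ge, dotProduct_eq_zero_add_tail, Fin.cons_zero, zero_mul, zero_add,
      Fin.tail_cons] at this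

lemma neg_le_eigenvalue_succ (hM : IsSpectralDecomposition (blockMatrix a N) l V)
    (hl : Antitone l) (hN : N.PosSemidef) {μ : Fin n → ℝ} {Q : Matrix (Fin n) (Fin n) ℝ}
    (hQ : IsSpectralDecomposition N μ Q) (hμ : Monotone μ) (i : Fin n) : -μ i ≤ l i.succ := by
  obtain ⟨u, hu0, hV, hQu⟩ := exists_ne_zero_eigencoordinates_eq_zero V Q i
  have hM_le : u ⬝ᵥ blockMatrix a N *ᵥ u ≤ l i.succ * (u ⬝ᵥ u) := by
    refine hM.dotProduct_mulVec_le fun k hk => ?_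
    have hki : k < i.succ := hl.reflect_lt hk
    obtain ⟨j, rfl⟩ := Fin.exists_castSucc_eq.2 (hki.trans_le (Fin.le_last _)).ne
    exact hV j (Fin.castSucc_lt_succ_iff.1 hki)
  have hN_le : Fin.tail u ⬝ᵥ N *ᵥ Fin.tail u ≤ μ i * (Fin.tail u ⬝ᵥ Fin.tail u) :=
    hQ.dotProduct_mulVec_le fun j hj => hQu j (hμ.reflect_lt hj)
  have hu_pos : 0 < u ⬝ᵥ u := by
    simpa only [star_trivial] using Matrix.dotProduct_self_star_pos_iff.2 hu0
  have htail : Fin.tail u ⬝ᵥ Fin.tail u ≤ u ⬝ᵥ u := by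
    rw [dotProduct_eq_zero_add_tail u u]
    linarith [mul_self_nonneg (u 0)]
  rw [dotProduct_blockMatrix_mulVec] at hM_le
  have : 0 ≤ (l i.succ + μ i) * (u ⬝ᵥ u) := by
    linarith [mul_self_nonneg ((blockMatrix a N *ᵥ u) 0),
      mul_le_mul_of_nonneg_left htail (hQ.nonneg hN i)]
  linarith [nonneg_of_mul_nonneg_left this hu_pos]

lemma eigencoordinate_zero_nonneg (hM : IsSpectralDecomposition (blockMatrix a N) l V)
    (hl : Antitone l) (hV : 0 < V 0 0) (hN : N.PosSemidef) {v : Fin (n + 1) → ℝ} (hv : 0 ≤ v 0)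
    {r : Fin n → ℝ} (hr : N *ᵥ r = v 0 • a - Fin.tail v) (hrv : r ⬝ᵥ N *ᵥ r ≤ v 0 ^ 2) :
    0 ≤ (Vᵀ *ᵥ v) 0 := by
  set p := V.col 0
  have hp : V 0 0 + a ⬝ᵥ Fin.tail p = l 0 * V 0 0 := by
    have := congrFun (hM.mulVec_col 0) 0
    rwa [blockMatrix_mulVec_zero] at this
  have hcoord : (Vᵀ *ᵥ v) 0 = l 0 * V 0 0 * v 0 - Fin.tail p ⬝ᵥ N *ᵥ r := by
    have : (Vᵀ *ᵥ v) 0 = V 0 0 * v 0 + Fin.tail p ⬝ᵥ Fin.tail v := dotProduct_eq_zero_add_tail _ _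
    rw [this, hr, ← hp, dotProduct_sub, dotProduct_smul, dotProduct_comm (Fin.tail p) a,
      smul_eq_mul]
    ring
  have hl0 := one_le_eigenvalue_zero hM hl
  have hcs : (Fin.tail p ⬝ᵥ N *ᵥ r) ^ 2 ≤ (l 0 * V 0 0 * v 0) ^ 2 := by
    refine (sq_dotProduct_mulVec_le hN _ _).trans ?_
    rw [tail_col_dotProduct_mulVec hM, mul_pow _ (v 0)]
    exact mul_le_mul (by linarith) hrv (dotProduct_mulVec_nonneg hN r) (sq_nonneg _)
  rw [hcoord]
  linarith [le_of_abs_le (abs_le_of_sq_le_sq hcs (by positivity))]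

lemma sum_sq_eigencoordinate_div_le (hM : IsSpectralDecomposition (blockMatrix a N) l V)
    (hl : Antitone l) (hN : N.PosSemidef) {μ : Fin n → ℝ} {Q : Matrix (Fin n) (Fin n) ℝ}
    (hQ : IsSpectralDecomposition N μ Q) (hμ : Monotone μ) (hμ_pos : ∀ i, 0 < μ i)
    {v : Fin (n + 1) → ℝ} {r : Fin n → ℝ} (hr : N *ᵥ r = v 0 • a - Fin.tail v)
    (hrv : r ⬝ᵥ N *ᵥ r ≤ v 0 ^ 2) :
    ∑ i : Fin n, (Vᵀ *ᵥ v) i.succ ^ 2 / μ i ≤ (Vᵀ *ᵥ v) 0 ^ 2 := by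
  set u : Fin (n + 1) → ℝ := Fin.cons (v 0 - a ⬝ᵥ r) r
  have huv : blockMatrix a N *ᵥ u = v := blockMatrix_mulVec_cons hr
  have hcoord (k : Fin (n + 1)) : (Vᵀ *ᵥ v) k = l k * (Vᵀ *ᵥ u) k := by
    rw [← huv, hM.transpose_mulVec]
  have hform : 0 ≤ ∑ k, l k * ((Vᵀ *ᵥ u) k * (Vᵀ *ᵥ u) k) := by
    rw [← hM.dotProduct_mulVec, dotProduct_blockMatrix_mulVec, huv, Fin.tail_cons]
    linarith
  rw [Fin.sum_univ_succ] at hform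
  calc ∑ i : Fin n, (Vᵀ *ᵥ v) i.succ ^ 2 / μ i
      ≤ ∑ i : Fin n, -(l i.succ * ((Vᵀ *ᵥ u) i.succ * (Vᵀ *ᵥ u) i.succ)) := by
        refine Finset.sum_le_sum fun i _ => ?_
        have hle := eigenvalue_succ_nonpos hM hl hN i
        have hge := neg_le_eigenvalue_succ hM hl hN hQ hμ i
        have : 0 ≤ -l i.succ * (l i.succ + μ i) * (Vᵀ *ᵥ u) i.succ ^ 2 :=
          mul_nonneg (mul_nonneg (by linarith) (by linarith)) (sq_nonneg _)
        rw [hcoord, div_le_iff₀ (hμ_pos i)]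
        linarith
    _ ≤ l 0 * 1 * (Vᵀ *ᵥ u) 0 ^ 2 := by
        rw [Finset.sum_neg_distrib]
        linarith
    _ ≤ l 0 * l 0 * (Vᵀ *ᵥ u) 0 ^ 2 := by
        have := one_le_eigenvalue_zero hM hl
        gcongr
    _ = (Vᵀ *ᵥ v) 0 ^ 2 := by rw [hcoord]; ring

end Block

/-! ### The half-ellipsoid update -/

/-- The matrix `N` of the cone update as a function of `w` and `b`: the matrix of the smallest
ellipsoid that contains the half of the ellipsoid of `diagonal w` in the direction `b`. -/
def cutMatrix {n : ℕ} (w b : Fin n → ℝ) : Matrix (Fin n) (Fin n) ℝ :=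
  if n = 1 then (1 / 4 : ℝ) • Matrix.diagonal w
  else ((n : ℝ) ^ 2 / ((n : ℝ) ^ 2 - 1)) •
    (Matrix.diagonal w - (2 / ((n : ℝ) + 1)) • Matrix.vecMulVec b b)

/-- The vector `W g / √(g' W g)` for `W = diagonal w`, the direction of a cut with normal `g`. -/
def cutVector {n : ℕ} (w g : Fin n → ℝ) : Fin n → ℝ :=
  fun i => (Real.sqrt (∑ i, w i * g i ^ 2))⁻¹ * (w i * g i)

lemma width_eq_sum {n : ℕ} (w : Fin n → ℝ) (U : Matrix (Fin (n + 1)) (Fin (n + 1)) ℝ)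
    (δ : Vec n) : width w U δ = ∑ i, w i * coords U δ i.succ ^ 2 := by
  simp only [width, dotProduct, Matrix.mulVec_diagonal]
  exact Finset.sum_congr rfl fun i _ => by ring

lemma updB_eq_cutVector {n : ℕ} (w : Fin n → ℝ) (U : Matrix (Fin (n + 1)) (Fin (n + 1)) ℝ)
    (δ : Vec n) : updB w U δ = cutVector w fun i => coords U δ i.succ := by
  ext i
  simp only [updB, cutVector, width_eq_sum, Pi.smul_apply, Matrix.mulVec_diagonal, smul_eq_mul]

lemma updN_eq_cutMatrix {n : ℕ} (w : Fin n → ℝ) (U : Matrix (Fin (n + 1)) (Fin (n + 1)) ℝ)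
    (δ : Vec n) : updN w U δ = cutMatrix w (cutVector w fun i => coords U δ i.succ) := by
  rw [← updB_eq_cutVector]
  rfl

lemma sq_sum_mul_mul_le {ι : Type*} [Fintype ι] {w g : ι → ℝ} {q : ℝ} (hw : ∀ i, 0 ≤ w i)
    (hq : ∑ i, w i * g i ^ 2 ≤ q) (v : ι → ℝ) :
    (∑ i, w i * g i * v i) ^ 2 ≤ q * ∑ i, w i * v i ^ 2 := by
  have hterm (u : ι → ℝ) (i : ι) : 0 ≤ w i * u i ^ 2 := mul_nonneg (hw i) (sq_nonneg _)
  calc (∑ i, w i * g i * v i) ^ 2 ≤ (∑ i, w i * g i ^ 2) * ∑ i, w i * v i ^ 2 :=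
        Finset.sum_sq_le_sum_mul_sum_of_sq_le_mul _ (fun i _ => hterm g i) (fun i _ => hterm v i)
          fun i _ => le_of_eq (by ring)
    _ ≤ q * ∑ i, w i * v i ^ 2 :=
        mul_le_mul_of_nonneg_right hq (Finset.sum_nonneg fun i _ => hterm v i)

lemma one_lt_sq_natCast {n : ℕ} (hn : 2 ≤ n) : (1 : ℝ) < (n : ℝ) ^ 2 := by
  exact_mod_cast Nat.one_lt_pow two_ne_zero hn

section Cut

variable {n : ℕ} {w b g : Fin n → ℝ}

lemma cutMatrix_one {w b : Fin 1 → ℝ} : cutMatrix w b = (1 / 4 : ℝ) • Matrix.diagonal w :=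
  if_pos rfl

lemma cutMatrix_mulVec (hn : n ≠ 1) (v : Fin n → ℝ) (i : Fin n) :
    (cutMatrix w b *ᵥ v) i = (n : ℝ) ^ 2 / ((n : ℝ) ^ 2 - 1) *
      (w i * v i - 2 / ((n : ℝ) + 1) * (b i * (b ⬝ᵥ v))) := by
  rw [cutMatrix, if_neg hn, Matrix.smul_mulVec, Matrix.sub_mulVec, Matrix.smul_mulVec,
    Matrix.vecMulVec_mulVec]
  simp only [Pi.smul_apply, Pi.sub_apply, Matrix.mulVec_diagonal, smul_eq_mul,
    MulOpposite.smul_eq_mul_unop, MulOpposite.unop_op]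

lemma dotProduct_cutMatrix_mulVec (hn : n ≠ 1) (v : Fin n → ℝ) :
    v ⬝ᵥ cutMatrix w b *ᵥ v = (n : ℝ) ^ 2 / ((n : ℝ) ^ 2 - 1) *
      (∑ i, w i * v i ^ 2 - 2 / ((n : ℝ) + 1) * (b ⬝ᵥ v) ^ 2) := by
  have hsq : (b ⬝ᵥ v) ^ 2 = ∑ i, b i * v i * (b ⬝ᵥ v) := by
    rw [← Finset.sum_mul, sq]
    rfl
  rw [dotProduct, hsq, Finset.mul_sum, ← Finset.sum_sub_distrib, Finset.mul_sum]
  simp only [cutMatrix_mulVec hn]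
  exact Finset.sum_congr rfl fun i _ => by ring

lemma dotProduct_cutMatrix_one_mulVec {w b : Fin 1 → ℝ} (v : Fin 1 → ℝ) :
    v ⬝ᵥ cutMatrix w b *ᵥ v = 1 / 4 * (w 0 * v 0 ^ 2) := by
  rw [cutMatrix_one, Matrix.smul_mulVec, dotProduct_smul, dotProduct, Fin.sum_univ_one,
    Matrix.mulVec_diagonal, smul_eq_mul]
  ring

lemma cutMatrix_isHermitian (w b : Fin n → ℝ) : (cutMatrix w b).IsHermitian := by
  have hW : (Matrix.diagonal w).IsHermitian := Matrix.isHermitian_diagonal w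
  have hb : (Matrix.vecMulVec b b).IsHermitian := by
    rw [Matrix.IsHermitian, Matrix.conjTranspose_eq_transpose_of_trivial,
      Matrix.transpose_vecMulVec]
  unfold cutMatrix
  split
  · exact hW.smul (.all _)
  · exact (hW.sub (hb.smul (.all _))).smul (.all _)

lemma cutMatrix_posSemidef (hb : ∀ v : Fin n → ℝ, (b ⬝ᵥ v) ^ 2 ≤ ∑ i, w i * v i ^ 2) :
    (cutMatrix w b).PosSemidef := by
  refine .of_dotProduct_mulVec_nonneg (cutMatrix_isHermitian w b) fun v => ?_
  rw [star_trivial]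
  have hv : 0 ≤ ∑ i, w i * v i ^ 2 := (sq_nonneg _).trans (hb v)
  rcases lt_trichotomy n 1 with hn | rfl | hn
  · obtain rfl : n = 0 := by lia
    exact le_of_eq (Finset.sum_empty).symm
  · rw [Fin.sum_univ_one] at hv
    rw [dotProduct_cutMatrix_one_mulVec]
    positivity
  · rw [dotProduct_cutMatrix_mulVec hn.ne']
    have hcoef : 2 / ((n : ℝ) + 1) ≤ 1 := by
      have : (1 : ℝ) < n := by exact_mod_cast hn
      rw [div_le_one (by positivity)]
      linarith
    refine mul_nonneg (div_nonneg (sq_nonneg _) (by linarith [one_lt_sq_natCast hn])) ?_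
    linarith [hb v, mul_le_mul_of_nonneg_right hcoef (sq_nonneg (b ⬝ᵥ v))]

lemma cutVector_dotProduct (v : Fin n → ℝ) :
    cutVector w g ⬝ᵥ v = (Real.sqrt (∑ i, w i * g i ^ 2))⁻¹ * ∑ i, w i * g i * v i := by
  simp only [cutVector, dotProduct, Finset.mul_sum, mul_assoc]

lemma sq_cutVector_dotProduct_le (hw : ∀ i, 0 ≤ w i) (v : Fin n → ℝ) :
    (cutVector w g ⬝ᵥ v) ^ 2 ≤ ∑ i, w i * v i ^ 2 := by
  have hform (u : Fin n → ℝ) : 0 ≤ ∑ i, w i * u i ^ 2 :=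
    Finset.sum_nonneg fun i _ => mul_nonneg (hw i) (sq_nonneg _)
  rw [cutVector_dotProduct, mul_pow, inv_pow, Real.sq_sqrt (hform g)]
  rcases (hform g).eq_or_lt with hq | hq
  · rw [← hq, inv_zero, zero_mul]
    exact hform v
  · rw [inv_mul_le_iff₀ hq]
    exact sq_sum_mul_mul_le hw le_rfl v

lemma sum_cutVector_sq_div (hw : ∀ i, 0 < w i) (hq : 0 < ∑ i, w i * g i ^ 2) :
    ∑ i, cutVector w g i ^ 2 / w i = 1 := by
  have hterm (i : Fin n) :
      cutVector w g i ^ 2 / w i = (∑ i, w i * g i ^ 2)⁻¹ * (w i * g i ^ 2) := by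
    have := (hw i).ne'
    rw [cutVector, mul_pow, inv_pow, Real.sq_sqrt hq.le]
    field_simp
  simp only [hterm]
  rw [← Finset.mul_sum, inv_mul_cancel₀ hq.ne']

/-- The Sherman-Morrison formula. -/
lemma exists_cutMatrix_mulVec_eq (hn : 2 ≤ n) (hw : ∀ i, 0 < w i)
    (hb : ∑ i, b i ^ 2 / w i = 1) (s : Fin n → ℝ) :
    ∃ r : Fin n → ℝ, cutMatrix w b *ᵥ r = s ∧
      r ⬝ᵥ s = ((n : ℝ) ^ 2 - 1) / (n : ℝ) ^ 2 *
        (∑ i, s i ^ 2 / w i + 2 / ((n : ℝ) - 1) * (∑ i, b i * s i / w i) ^ 2) := by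
  have hn2 : (2 : ℝ) ≤ n := by exact_mod_cast hn
  have hsub : (n : ℝ) - 1 ≠ 0 := by linarith
  have hsq : (n : ℝ) ^ 2 - 1 ≠ 0 := by linarith [one_lt_sq_natCast hn]
  set β := ∑ i, b i * s i / w i with hβ
  set r : Fin n → ℝ := fun i =>
    ((n : ℝ) ^ 2 - 1) / (n : ℝ) ^ 2 * (s i / w i + 2 / ((n : ℝ) - 1) * (b i / w i * β)) with hr
  have hbr : b ⬝ᵥ r = ((n : ℝ) ^ 2 - 1) / (n : ℝ) ^ 2 * (β + 2 / ((n : ℝ) - 1) * β) := by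
    have hterm (i : Fin n) : b i * r i = ((n : ℝ) ^ 2 - 1) / (n : ℝ) ^ 2 *
        (b i * s i / w i + 2 / ((n : ℝ) - 1) * β * (b i ^ 2 / w i)) := by rw [hr]; ring
    simp only [dotProduct, hterm, ← Finset.mul_sum, Finset.sum_add_distrib, hb, ← hβ, mul_one]
  refine ⟨r, funext fun i => ?_, ?_⟩
  · have := (hw i).ne'
    rw [cutMatrix_mulVec (by lia), hbr]
    simp only [hr]
    field_simp
    ring
  · have hterm (i : Fin n) : r i * s i = ((n : ℝ) ^ 2 - 1) / (n : ℝ) ^ 2 *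
        (s i ^ 2 / w i + 2 / ((n : ℝ) - 1) * β * (b i * s i / w i)) := by rw [hr]; ring
    simp only [dotProduct, hterm, ← Finset.mul_sum, Finset.sum_add_distrib, ← hβ]
    ring

lemma exists_shift_of_mem_halfInterval {w b z : Fin 1 → ℝ} {y : ℝ} (hw : 0 < w 0)
    (hb : b 0 ^ 2 = w 0) (ht : 0 ≤ b 0 * z 0 / w 0) (hty : b 0 * z 0 / w 0 ≤ y) :
    ∃ r : Fin 1 → ℝ, cutMatrix w b *ᵥ r = y • ((2 : ℝ)⁻¹ • b) - z ∧
      r ⬝ᵥ cutMatrix w b *ᵥ r ≤ y ^ 2 := by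
  set t := b 0 * z 0 / w 0 with ht_def
  have hz : z 0 = t * b 0 := by
    rw [ht_def, div_mul_eq_mul_div, eq_div_iff hw.ne', ← hb]
    ring
  refine ⟨fun i => 4 * (y * ((2 : ℝ)⁻¹ * b i) - z i) / w i, funext fun i => ?_, ?_⟩
  · obtain rfl : i = 0 := Subsingleton.elim _ _
    rw [cutMatrix_one, Matrix.smul_mulVec]
    simp only [Pi.smul_apply, Matrix.mulVec_diagonal, smul_eq_mul, Pi.sub_apply]
    field_simp
  · have hsq : 1 / 4 * (w 0 * (4 * (y * ((2 : ℝ)⁻¹ * b 0) - z 0) / w 0) ^ 2) =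
        (y - 2 * t) ^ 2 := by
      rw [hz]
      field_simp
      rw [hb]
      ring
    rw [dotProduct_cutMatrix_one_mulVec, hsq]
    nlinarith

lemma exists_shift_of_mem_halfEllipsoid_of_two_le (hn : 2 ≤ n) (hw : ∀ i, 0 < w i)
    (hb : ∑ i, b i ^ 2 / w i = 1) {y : ℝ} {z : Fin n → ℝ} (hz : ∑ i, z i ^ 2 / w i ≤ y ^ 2)
    (ht : 0 ≤ ∑ i, b i * z i / w i) (hty : ∑ i, b i * z i / w i ≤ y) :
    ∃ r : Fin n → ℝ, cutMatrix w b *ᵥ r = y • (((n : ℝ) + 1)⁻¹ • b) - z ∧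
      r ⬝ᵥ cutMatrix w b *ᵥ r ≤ y ^ 2 := by
  set t := ∑ i, b i * z i / w i
  set s : Fin n → ℝ := y • (((n : ℝ) + 1)⁻¹ • b) - z
  have hs (i : Fin n) : s i = y / (n + 1) * b i - z i := by
    change y * (((n : ℝ) + 1)⁻¹ * b i) - z i = _
    ring
  have hbs : ∑ i, b i * s i / w i = y / (n + 1) - t := by
    have hterm (i : Fin n) :
        b i * s i / w i = y / (n + 1) * (b i ^ 2 / w i) - b i * z i / w i := by rw [hs]; ring
    simp only [hterm, Finset.sum_sub_distrib, ← Finset.mul_sum, hb, mul_one, t]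
  have hss : ∑ i, s i ^ 2 / w i = (y / (n + 1)) ^ 2 - 2 * (y / (n + 1)) * t +
      ∑ i, z i ^ 2 / w i := by
    have hterm (i : Fin n) : s i ^ 2 / w i = (y / (n + 1)) ^ 2 * (b i ^ 2 / w i) -
        2 * (y / (n + 1)) * (b i * z i / w i) + z i ^ 2 / w i := by rw [hs]; ring
    simp only [hterm, Finset.sum_add_distrib, Finset.sum_sub_distrib, ← Finset.mul_sum, hb,
      mul_one, t]
  obtain ⟨r, hr, hrs⟩ := exists_cutMatrix_mulVec_eq hn hw hb s
  refine ⟨r, hr, ?_⟩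
  rw [hr, hrs, hbs, hss]
  have hn2 : (2 : ℝ) ≤ n := by exact_mod_cast hn
  have hsub : (n : ℝ) - 1 ≠ 0 := by linarith
  calc ((n : ℝ) ^ 2 - 1) / (n : ℝ) ^ 2 * ((y / (n + 1)) ^ 2 - 2 * (y / (n + 1)) * t +
        ∑ i, z i ^ 2 / w i + 2 / ((n : ℝ) - 1) * (y / (n + 1) - t) ^ 2)
      ≤ ((n : ℝ) ^ 2 - 1) / (n : ℝ) ^ 2 * ((y / (n + 1)) ^ 2 - 2 * (y / (n + 1)) * t +
        y ^ 2 + 2 / ((n : ℝ) - 1) * (y / (n + 1) - t) ^ 2) :=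
        mul_le_mul_of_nonneg_left (by linarith)
          (div_nonneg (by linarith [one_lt_sq_natCast hn]) (sq_nonneg _))
    _ = y ^ 2 - 2 * ((n : ℝ) + 1) / (n : ℝ) ^ 2 * (t * (y - t)) := by
        field_simp
        ring
    _ ≤ y ^ 2 := sub_le_self _
        (mul_nonneg (by positivity) (mul_nonneg ht (by linarith)))

/-- A point `z` of the half ellipsoid `z' W⁻¹ z ≤ y²`, `b' W⁻¹ z ≥ 0` lies in the ellipsoid of the
cut matrix `N` around `y b / d`; the point is given by `r` in the form `y b / d - N r`, which does
not mention the inverse of `N`. -/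
lemma exists_shift_of_mem_halfEllipsoid (hn : n ≠ 0) (hw : ∀ i, 0 < w i)
    (hb : ∑ i, b i ^ 2 / w i = 1) {y : ℝ} {z : Fin n → ℝ} (hy : 0 ≤ y)
    (hz : ∑ i, z i ^ 2 / w i ≤ y ^ 2) (ht : 0 ≤ ∑ i, b i * z i / w i) :
    ∃ r : Fin n → ℝ, cutMatrix w b *ᵥ r = y • (((n : ℝ) + 1)⁻¹ • b) - z ∧
      r ⬝ᵥ cutMatrix w b *ᵥ r ≤ y ^ 2 := by
  have hty : ∑ i, b i * z i / w i ≤ y := by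
    refine le_of_sq_le_sq (le_trans (Finset.sum_sq_le_sum_mul_sum_of_sq_le_mul _
      (f := fun i => b i ^ 2 / w i) (g := fun i => z i ^ 2 / w i)
      (fun i _ => div_nonneg (sq_nonneg _) (hw i).le)
      (fun i _ => div_nonneg (sq_nonneg _) (hw i).le) fun i _ => le_of_eq (by ring)) ?_) hy
    rwa [hb, one_mul]
  rcases Nat.lt_or_ge n 2 with hn1 | hn2
  · obtain rfl : n = 1 := by lia
    rw [Fin.sum_univ_one] at hb ht hty
    rw [Nat.cast_one, one_add_one_eq_two]
    exact exists_shift_of_mem_halfInterval (hw 0) ((div_eq_one_iff_eq (hw 0).ne').1 hb) ht hty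
  · exact exists_shift_of_mem_halfEllipsoid_of_two_le hn2 hw hb hz ht hty

/-! ### Decrease of the determinant -/

lemma sq_add_mul_log_le {x : ℝ} (hx0 : 0 ≤ x) (hx1 : x < 1) :
    x ^ 2 + x * (Real.log (1 - x) - Real.log (1 + x)) ≤ Real.log (1 - x ^ 2) := by
  have hx : |x| < 1 := by rwa [abs_of_nonneg hx0]
  have hx2 : |x ^ 2| < 1 := by rwa [abs_of_nonneg (sq_nonneg x), sq_lt_one_iff₀ hx0]
  have hsum := ((Real.hasSum_log_sub_log_of_abs_lt_one hx).mul_left x).sub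
    (Real.hasSum_pow_div_log_of_abs_lt_one hx2)
  have hfirst := sum_le_hasSum {0} (fun k _ => ?_) hsum
  · rw [Finset.sum_singleton] at hfirst
    norm_num at hfirst
    linarith
  · have hterm : x * (2 * (1 / (2 * (k : ℝ) + 1)) * x ^ (2 * k + 1)) =
        (x ^ 2) ^ (k + 1) * (2 / (2 * (k : ℝ) + 1)) := by ring
    rw [sub_nonneg, div_eq_mul_one_div, hterm]
    refine mul_le_mul_of_nonneg_left ?_ (by positivity)
    rw [div_le_div_iff₀ (by positivity) (by positivity)]
    linarith

lemma cut_volume_ratio_le (hn : 2 ≤ n) :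
    ((n : ℝ) ^ 2 / ((n : ℝ) ^ 2 - 1)) ^ n * (1 - 2 / ((n : ℝ) + 1)) ≤
      Real.exp (-(1 / (n : ℝ))) := by
  have hn2 : (2 : ℝ) ≤ n := by exact_mod_cast hn
  have hsq : (n : ℝ) ^ 2 - 1 ≠ 0 := by linarith [one_lt_sq_natCast hn]
  set x := 1 / (n : ℝ) with hx
  have hx0 : 0 < x := by positivity
  have hx1 : x < 1 := by rw [hx, div_lt_one (by positivity)]; linarith
  have hnx : (n : ℝ) * x = 1 := mul_one_div_cancel (by positivity)
  have hlow : 1 - 2 / ((n : ℝ) + 1) = (1 - x) / (1 + x) := by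
    rw [hx]
    field_simp
    ring
  have hhigh : (n : ℝ) ^ 2 / ((n : ℝ) ^ 2 - 1) = (1 - x ^ 2)⁻¹ := by
    rw [hx]
    field_simp
  have hsub : 0 < 1 - x := by linarith
  have hsq_sub : 0 < 1 - x ^ 2 := by nlinarith
  rw [hlow, hhigh, ← Real.log_le_iff_le_exp (by positivity),
    Real.log_mul (by positivity) (by positivity), Real.log_pow, Real.log_inv,
    Real.log_div hsub.ne' (by positivity)]
  have key := mul_le_mul_of_nonneg_left (sq_add_mul_log_le hx0.le hx1) (Nat.cast_nonneg (α := ℝ) n)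
  have hexpand : (n : ℝ) * (x ^ 2 + x * (Real.log (1 - x) - Real.log (1 + x))) =
      n * x * (x + (Real.log (1 - x) - Real.log (1 + x))) := by ring
  rw [hexpand, hnx] at key
  linarith

lemma det_cutMatrix (hn : n ≠ 1) (hw : ∀ i, 0 < w i) (hb : ∑ i, b i ^ 2 / w i = 1) :
    (cutMatrix w b).det = ((n : ℝ) ^ 2 / ((n : ℝ) ^ 2 - 1)) ^ n *
      ((1 - 2 / ((n : ℝ) + 1)) * ∏ i, w i) := by
  set k := 2 / ((n : ℝ) + 1)
  have hfactor : Matrix.diagonal w - k • Matrix.vecMulVec b b = Matrix.diagonal w *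
      (1 + Matrix.replicateCol Unit (fun i => -k * (b i / w i)) * Matrix.replicateRow Unit b) := by
    ext i j
    have := (hw i).ne'
    rw [Matrix.mul_add, Matrix.mul_one, Matrix.add_apply, Matrix.diagonal_mul]
    simp only [Matrix.sub_apply, Matrix.smul_apply, Matrix.vecMulVec_apply, smul_eq_mul,
      Matrix.mul_apply, Matrix.replicateCol_apply, Matrix.replicateRow_apply,
      Finset.univ_unique, Finset.sum_singleton]
    field_simp
    ring
  have htrace : b ⬝ᵥ (fun i => -k * (b i / w i)) = -k := by
    have hterm (i : Fin n) : b i * (-k * (b i / w i)) = -k * (b i ^ 2 / w i) := by ring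
    simp only [dotProduct, hterm, ← Finset.mul_sum, hb, mul_one]
  rw [cutMatrix, if_neg hn, Matrix.det_smul, hfactor, Matrix.det_mul, Matrix.det_diagonal,
    Matrix.det_one_add_replicateCol_mul_replicateRow, Fintype.card_fin, htrace]
  ring

lemma det_cutMatrix_le (hn : n ≠ 0) (hw : ∀ i, 0 < w i) (hb : ∑ i, b i ^ 2 / w i = 1) :
    (cutMatrix w b).det ≤ Real.exp (-(1 / (n : ℝ))) * ∏ i, w i := by
  have hprod : 0 ≤ ∏ i, w i := Finset.prod_nonneg fun i _ => (hw i).le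
  rcases eq_or_ne n 1 with rfl | hn1
  · have hexp : 1 / 4 ≤ Real.exp (-1) := by
      rw [Real.exp_neg, one_div]
      exact inv_anti₀ (Real.exp_pos 1) (by linarith [Real.exp_one_lt_d9])
    rw [cutMatrix_one, Matrix.det_smul, Matrix.det_diagonal, Fintype.card_fin, pow_one,
      Nat.cast_one, div_one]
    exact mul_le_mul_of_nonneg_right hexp hprod
  · rw [det_cutMatrix hn1 hw hb, ← mul_assoc]
    exact mul_le_mul_of_nonneg_right (cut_volume_ratio_le (by lia)) hprod

/-! ### Lower bound on the eigenvalues -/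

lemma two_div_mul_sq_cutVector_dotProduct_le (hn : 2 ≤ n) {m : ℝ} (hm : 0 ≤ m)
    (hw : ∀ i, m ≤ w i) (hg : g ⬝ᵥ g ≤ 1) (hq : 0 < ∑ i, w i * g i ^ 2)
    (hmq : 4 * (n : ℝ) ^ 2 * m ≤ ∑ i, w i * g i ^ 2) (v : Fin n → ℝ) :
    2 / ((n : ℝ) + 1) * (cutVector w g ⬝ᵥ v) ^ 2 ≤
      ∑ i, (w i - m) * v i ^ 2 + m * (v ⬝ᵥ v) / (n : ℝ) ^ 2 := by
  -- Split `W = m I + (W - m I)`. The two parts `P`, `S` of `√q b' v` are bounded by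
  -- Cauchy-Schwarz, and `(P + S)² ≤ (n + 1) (P² / (n - 1) + S² / 2)`.
  set q := ∑ i, w i * g i ^ 2 with hq_def
  set P := ∑ i, m * g i * v i
  set S := ∑ i, (w i - m) * g i * v i
  have hn2 : (2 : ℝ) ≤ n := by exact_mod_cast hn
  have hv : ∑ i, m * v i ^ 2 = m * (v ⬝ᵥ v) := by simp only [dotProduct, Finset.mul_sum, sq]
  have hP : P ^ 2 ≤ q / (4 * (n : ℝ) ^ 2) * (m * (v ⬝ᵥ v)) := by
    rw [← hv]
    refine sq_sum_mul_mul_le (fun _ => hm) ?_ v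
    have hmg : ∑ i, m * g i ^ 2 = m * (g ⬝ᵥ g) := by simp only [dotProduct, Finset.mul_sum, sq]
    rw [hmg, le_div_iff₀ (by positivity)]
    nlinarith [mul_le_mul_of_nonneg_left hg (mul_nonneg hm (sq_nonneg (n : ℝ)))]
  have hS : S ^ 2 ≤ q * ∑ i, (w i - m) * v i ^ 2 :=
    sq_sum_mul_mul_le (fun i => sub_nonneg.2 (hw i)) (Finset.sum_le_sum fun i _ =>
      mul_le_mul_of_nonneg_right (sub_le_self _ hm) (sq_nonneg _)) v
  have hPS : cutVector w g ⬝ᵥ v = (Real.sqrt q)⁻¹ * (P + S) := by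
    rw [cutVector_dotProduct, ← hq_def, ← Finset.sum_add_distrib]
    exact congrArg _ (Finset.sum_congr rfl fun i _ => by ring)
  have hweighted : 2 / ((n : ℝ) + 1) * (P + S) ^ 2 ≤ S ^ 2 + 2 / ((n : ℝ) - 1) * P ^ 2 := by
    have hsub : 0 < (n : ℝ) - 1 := by linarith
    have hdiff : S ^ 2 + 2 / ((n : ℝ) - 1) * P ^ 2 - 2 / ((n : ℝ) + 1) * (P + S) ^ 2 =
        (((n : ℝ) - 1) * S - 2 * P) ^ 2 / (((n : ℝ) - 1) * ((n : ℝ) + 1)) := by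
      field_simp
      ring
    rw [← sub_nonneg, hdiff]
    positivity
  have hcoef : 2 / ((n : ℝ) - 1) * P ^ 2 ≤ 4 * P ^ 2 :=
    mul_le_mul_of_nonneg_right
      ((div_le_iff₀ (by linarith)).2 (by linarith)) (sq_nonneg _)
  have hP4 : 4 * P ^ 2 ≤ q * (m * (v ⬝ᵥ v) / (n : ℝ) ^ 2) := by
    refine (mul_le_mul_of_nonneg_left hP zero_le_four).trans_eq ?_
    field_simp
  rw [hPS, mul_pow, inv_pow, Real.sq_sqrt hq.le, mul_left_comm, inv_mul_le_iff₀ hq]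
  linarith

lemma le_dotProduct_cutMatrix_mulVec (hn : n ≠ 0) {m : ℝ} (hm : 0 ≤ m) (hw : ∀ i, m ≤ w i)
    (hg : g ⬝ᵥ g ≤ 1) (hq : 0 < ∑ i, w i * g i ^ 2)
    (hmq : 4 * (n : ℝ) ^ 2 * m ≤ ∑ i, w i * g i ^ 2) (v : Fin n → ℝ) :
    m * (v ⬝ᵥ v) ≤ v ⬝ᵥ cutMatrix w (cutVector w g) *ᵥ v := by
  rcases Nat.lt_or_ge n 2 with hn1 | hn2
  · obtain rfl : n = 1 := by lia
    rw [dotProduct, Fin.sum_univ_one] at hg ⊢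
    rw [Fin.sum_univ_one, Nat.cast_one] at hmq
    rw [dotProduct_cutMatrix_one_mulVec]
    have hw4 : 4 * m ≤ w 0 := by nlinarith [hw 0]
    nlinarith [mul_le_mul_of_nonneg_right hw4 (sq_nonneg (v 0))]
  · have hsq := one_lt_sq_natCast hn2
    have hne : (n : ℝ) ^ 2 - 1 ≠ 0 := by linarith
    have hsplit : ∑ i, w i * v i ^ 2 = m * (v ⬝ᵥ v) + ∑ i, (w i - m) * v i ^ 2 := by
      rw [dotProduct, Finset.mul_sum, ← Finset.sum_add_distrib]
      exact Finset.sum_congr rfl fun i _ => by ring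
    have hcut := two_div_mul_sq_cutVector_dotProduct_le hn2 hm hw hg hq hmq v
    rw [dotProduct_cutMatrix_mulVec (by lia)]
    calc m * (v ⬝ᵥ v)
        = (n : ℝ) ^ 2 / ((n : ℝ) ^ 2 - 1) * (m * (v ⬝ᵥ v) - m * (v ⬝ᵥ v) / (n : ℝ) ^ 2) := by
          have : (n : ℝ) ≠ 0 := by exact_mod_cast hn
          field_simp
      _ ≤ _ := mul_le_mul_of_nonneg_left (by linarith) (div_nonneg (sq_nonneg _) (by linarith))

end Cut

/-! ### Coordinates -/

section Coords

variable {n : ℕ} {U : Matrix (Fin (n + 1)) (Fin (n + 1)) ℝ} {w : Fin n → ℝ}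

/-- The axis `U e₁` of an ellipsoidal cone. -/
def axis (U : Matrix (Fin (n + 1)) (Fin (n + 1)) ℝ) : Vec n := WithLp.toLp 2 fun i => U i 0

lemma coords_zero (U : Matrix (Fin (n + 1)) (Fin (n + 1)) ℝ) (c : Vec n) :
    coords U c 0 = inner ℝ c (axis U) := by
  rw [EuclideanSpace.inner_eq_star_dotProduct, star_trivial]
  rfl

lemma coords_mulVec (hU : U ∈ Matrix.orthogonalGroup (Fin (n + 1)) ℝ) (y : Fin (n + 1) → ℝ) :
    coords U (WithLp.toLp 2 (U *ᵥ y)) = y :=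
  transpose_mulVec_mulVec hU y

lemma coords_mul (U V : Matrix (Fin (n + 1)) (Fin (n + 1)) ℝ) (c : Vec n) :
    coords (U * V) c = Vᵀ *ᵥ coords U c := by
  rw [coords, coords, Matrix.mulVec_mulVec, Matrix.transpose_mul]

lemma inner_eq_coords (hU : U ∈ Matrix.orthogonalGroup (Fin (n + 1)) ℝ) (c v : Vec n) :
    inner ℝ c v = coords U c 0 * coords U v 0 +
      ∑ i : Fin n, coords U c i.succ * coords U v i.succ := by
  rw [← Fin.sum_univ_succ fun i => coords U c i * coords U v i, ← dotProduct, coords, coords,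
    dotProduct_transpose_mulVec hU, EuclideanSpace.inner_eq_star_dotProduct, star_trivial,
    dotProduct_comm]

lemma norm_sq_eq_coords (hU : U ∈ Matrix.orthogonalGroup (Fin (n + 1)) ℝ) (c : Vec n) :
    ‖c‖ ^ 2 = coords U c 0 ^ 2 + ∑ i : Fin n, coords U c i.succ ^ 2 := by
  rw [← real_inner_self_eq_norm_sq, inner_eq_coords hU]
  simp only [sq]

lemma sq_coords_zero_le (hU : U ∈ Matrix.orthogonalGroup (Fin (n + 1)) ℝ) (c : Vec n) :
    coords U c 0 ^ 2 ≤ ‖c‖ ^ 2 := by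
  rw [norm_sq_eq_coords hU]
  exact le_add_of_nonneg_right (Finset.sum_nonneg fun i _ => sq_nonneg _)

lemma sum_sq_coords_succ_le (hU : U ∈ Matrix.orthogonalGroup (Fin (n + 1)) ℝ) (c : Vec n) :
    ∑ i : Fin n, coords U c i.succ ^ 2 ≤ ‖c‖ ^ 2 := by
  rw [norm_sq_eq_coords hU]
  exact le_add_of_nonneg_left (sq_nonneg _)

lemma norm_axis (hU : U ∈ Matrix.orthogonalGroup (Fin (n + 1)) ℝ) : ‖axis U‖ = 1 := by
  have h : ‖axis U‖ ^ 2 = 1 := by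
    rw [← real_inner_self_eq_norm_sq, EuclideanSpace.inner_eq_star_dotProduct, star_trivial]
    exact dotProduct_col_self hU 0
  exact (pow_eq_one_iff_of_nonneg (norm_nonneg _) two_ne_zero).1 h

/-! ### Angles to the axis of a cone -/

lemma theta_nonneg (c v : Vec n) : 0 ≤ theta c v := by
  unfold theta
  split_ifs
  exacts [le_rfl, InnerProductGeometry.angle_nonneg _ _]

lemma theta_le_pi (c v : Vec n) : theta c v ≤ Real.pi := by
  unfold theta
  split_ifs
  exacts [Real.pi_pos.le, InnerProductGeometry.angle_le_pi _ _]

lemma theta_eq_arccos {c : Vec n} (hc : c ≠ 0) (v : Vec n) :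
    theta c v = Real.arccos (inner ℝ c v / (‖c‖ * ‖v‖)) :=
  if_neg hc

lemma cos_theta_mul_norm_mul_norm {c : Vec n} (hc : c ≠ 0) (v : Vec n) :
    Real.cos (theta c v) * (‖c‖ * ‖v‖) = inner ℝ c v := by
  rw [theta, if_neg hc, InnerProductGeometry.cos_angle_mul_norm_mul_norm]

lemma theta_le_iSup {C : Set (Vec n)} {c : Vec n} (hc : c ∈ C) (v : Vec n) :
    theta c v ≤ ⨆ c : C, theta (c : Vec n) v :=
  le_ciSup (f := fun c : C => theta (c : Vec n) v)
    ⟨Real.pi, by rintro _ ⟨c, rfl⟩; exact theta_le_pi _ _⟩ ⟨c, hc⟩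

lemma iSup_theta_nonneg (C : Set (Vec n)) (v : Vec n) : 0 ≤ ⨆ c : C, theta (c : Vec n) v :=
  Real.iSup_nonneg fun _ => theta_nonneg _ _

lemma uncertaintyAngle_nonneg (C : Set (Vec n)) : 0 ≤ uncertaintyAngle C :=
  Real.iInf_nonneg fun _ => iSup_theta_nonneg C _

lemma uncertaintyAngle_le_iSup_theta (C : Set (Vec n)) {v : Vec n} (hv : ‖v‖ = 1) :
    uncertaintyAngle C ≤ ⨆ c : C, theta (c : Vec n) v :=
  ciInf_le (f := fun v : Metric.sphere (0 : Vec n) 1 => ⨆ c : C, theta (c : Vec n) v)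
    ⟨0, by rintro _ ⟨v, rfl⟩; exact iSup_theta_nonneg C _⟩ ⟨v, by simpa using hv⟩

lemma mem_ellipsoidalCone_of_theta_le (hU : U ∈ Matrix.orthogonalGroup (Fin (n + 1)) ℝ) {α : ℝ}
    (hα : α < Real.pi / 2) {c : Vec n} (hc : theta c (axis U) ≤ α) :
    c ∈ ellipsoidalCone (fun _ => Real.tan α ^ 2) U := by
  have hα0 : 0 ≤ α := (theta_nonneg c _).trans hc
  have hcos : 0 < Real.cos α := Real.cos_pos_of_mem_Ioo ⟨by linarith [Real.pi_pos], hα⟩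
  have hy : Real.cos α * ‖c‖ ≤ coords U c 0 := by
    rcases eq_or_ne c 0 with rfl | hc0
    · rw [coords_zero, inner_zero_left, norm_zero, mul_zero]
    · rw [coords_zero, ← cos_theta_mul_norm_mul_norm hc0, norm_axis hU, mul_one]
      gcongr
      exact Real.cos_le_cos_of_nonneg_of_le_pi (theta_nonneg _ _) (by linarith [Real.pi_pos]) hc
  have hy0 : 0 ≤ Real.cos α * ‖c‖ := by positivity
  have htan : 1 + Real.tan α ^ 2 = (Real.cos α ^ 2)⁻¹ :=
    eq_inv_of_mul_eq_one_left (by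
      rw [add_mul, ← mul_pow, Real.tan_mul_cos hcos.ne', one_mul, Real.cos_sq_add_sin_sq])
  have hnorm : ‖c‖ ^ 2 ≤ (1 + Real.tan α ^ 2) * coords U c 0 ^ 2 := by
    rw [htan, le_inv_mul_iff₀ (by positivity), ← mul_pow]
    gcongr
  have hsum : ∑ i : Fin n, coords U c i.succ ^ 2 ≤ Real.tan α ^ 2 * coords U c 0 ^ 2 := by
    linarith [norm_sq_eq_coords hU c]
  refine ⟨hy0.trans hy, fun i hi => ?_, ?_⟩
  · have hle := (Finset.single_le_sum (f := fun i : Fin n => coords U c i.succ ^ 2)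
      (fun i _ => sq_nonneg _) (Finset.mem_univ i)).trans hsum
    rw [show Real.tan α ^ 2 = 0 from hi, zero_mul] at hle
    exact pow_eq_zero_iff two_ne_zero |>.1 (le_antisymm hle (sq_nonneg _))
  · rw [← Finset.sum_div]
    exact div_le_of_le_mul₀ (sq_nonneg _) (sq_nonneg _) (by linarith)

/-! ### The circumcenter of an ellipsoidal cone -/

/-- The half-angle of an ellipsoidal cone with squared widths `w`, attained in the direction of the
largest width. With no widths at all (`d = 1`) the supremum is `0` and the cone is a ray. -/
def aperture (w : Fin n → ℝ) : ℝ := Real.arccos (1 / Real.sqrt (1 + ⨆ i, w i))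

lemma one_le_sqrt_one_add_iSup (hw : ∀ i, 0 ≤ w i) : 1 ≤ Real.sqrt (1 + ⨆ i, w i) :=
  Real.one_le_sqrt.2 (le_add_of_nonneg_right (Real.iSup_nonneg hw))

lemma sum_sq_le_iSup_mul_sum_sq_div (hw : ∀ i, 0 ≤ w i) {z : Fin n → ℝ}
    (hz : ∀ i, w i = 0 → z i = 0) : ∑ i, z i ^ 2 ≤ (⨆ i, w i) * ∑ i, z i ^ 2 / w i := by
  rw [Finset.mul_sum]
  refine Finset.sum_le_sum fun i _ => ?_
  rcases (hw i).eq_or_lt with h | h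
  · rw [hz i h.symm, zero_pow two_ne_zero, zero_div, mul_zero]
  · rw [← mul_div_assoc, le_div_iff₀ h, mul_comm]
    exact mul_le_mul_of_nonneg_right (le_ciSup (Set.finite_range w).bddAbove i) (sq_nonneg _)

lemma exists_sum_mul_nonpos_of_sum_sq_eq_iSup (hw : ∀ i, 0 ≤ w i) (h : Fin n → ℝ) :
    ∃ z : Fin n → ℝ, ∑ i, z i * h i ≤ 0 ∧ ∑ i, z i ^ 2 = ⨆ i, w i ∧
      (∀ i, w i = 0 → z i = 0) ∧ ∑ i, z i ^ 2 / w i ≤ 1 := by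
  rcases isEmpty_or_nonempty (Fin n) with hn | hn
  · exact ⟨0, by simp, by simp, by simp, by simp⟩
  obtain ⟨k, hk⟩ := exists_eq_ciSup_of_finite (f := w)
  obtain ⟨r, hr, hrh⟩ : ∃ r : ℝ, r ^ 2 = w k ∧ r * h k ≤ 0 := by
    rcases le_total 0 (h k) with h0 | h0
    · exact ⟨-Real.sqrt (w k), by rw [neg_sq, Real.sq_sqrt (hw k)],
        mul_nonpos_of_nonpos_of_nonneg (neg_nonpos.2 (Real.sqrt_nonneg _)) h0⟩
    · exact ⟨Real.sqrt (w k), Real.sq_sqrt (hw k),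
        mul_nonpos_of_nonneg_of_nonpos (Real.sqrt_nonneg _) h0⟩
  refine ⟨Pi.single k r, ?_, ?_, fun i hi => ?_, ?_⟩
  · simpa [Pi.single_apply] using hrh
  · simpa [Pi.single_apply, ← hk] using hr
  · rcases eq_or_ne i k with rfl | hik
    · simpa [hi] using hr
    · exact Pi.single_eq_of_ne (M := fun _ => ℝ) hik r
  · rw [Finset.sum_eq_single k (fun i _ hi => by simp [hi]) (by simp), Pi.single_eq_same, hr]
    exact div_self_le_one _

lemma exists_mem_ellipsoidalCone_inner_le (hU : U ∈ Matrix.orthogonalGroup (Fin (n + 1)) ℝ)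
    (hw : ∀ i, 0 ≤ w i) (v : Vec n) :
    ∃ c ∈ ellipsoidalCone w U, ‖c‖ = Real.sqrt (1 + ⨆ i, w i) ∧
      inner ℝ c v ≤ inner ℝ v (axis U) := by
  obtain ⟨z, hzv, hz_sq, hz0, hz1⟩ :=
    exists_sum_mul_nonpos_of_sum_sq_eq_iSup hw fun i => coords U v i.succ
  set c : Vec n := WithLp.toLp 2 (U *ᵥ (Fin.cons 1 z))
  have hc : coords U c = Fin.cons 1 z := coords_mulVec hU _
  refine ⟨c, ⟨?_, fun i hi => ?_, ?_⟩, ?_, ?_⟩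
  · simp [hc]
  · simpa [hc] using hz0 i hi
  · simpa [hc] using hz1
  · rw [← Real.sqrt_sq (norm_nonneg c), norm_sq_eq_coords hU, hc]
    simp [hz_sq]
  · rw [inner_eq_coords hU, hc, ← coords_zero]
    simpa using hzv

lemma nonempty_ellipsoidalCone (hU : U ∈ Matrix.orthogonalGroup (Fin (n + 1)) ℝ)
    (hw : ∀ i, 0 ≤ w i) : (ellipsoidalCone w U).Nonempty := by
  obtain ⟨c, hc, -⟩ := exists_mem_ellipsoidalCone_inner_le hU hw 0
  exact ⟨c, hc⟩

lemma theta_axis_le_aperture (hU : U ∈ Matrix.orthogonalGroup (Fin (n + 1)) ℝ)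
    (hw : ∀ i, 0 ≤ w i) {c : Vec n} (hc : c ∈ ellipsoidalCone w U) :
    theta c (axis U) ≤ aperture w := by
  obtain ⟨hc0, hcz, hcs⟩ := hc
  have hσ : 0 ≤ ⨆ i, w i := Real.iSup_nonneg hw
  rcases eq_or_ne c 0 with rfl | hne
  · rw [theta, if_pos rfl]
    exact Real.arccos_nonneg _
  rw [theta_eq_arccos hne, ← coords_zero, norm_axis hU, mul_one]
  refine Real.arccos_le_arccos ?_
  rw [div_le_div_iff₀ (by positivity) (norm_pos_iff.2 hne), one_mul]
  refine le_of_sq_le_sq ?_ (by positivity)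
  rw [mul_pow, Real.sq_sqrt (by positivity)]
  calc ‖c‖ ^ 2 = coords U c 0 ^ 2 + ∑ i : Fin n, coords U c i.succ ^ 2 := norm_sq_eq_coords hU c
    _ ≤ coords U c 0 ^ 2 + (⨆ i, w i) * coords U c 0 ^ 2 := by
        gcongr
        exact (sum_sq_le_iSup_mul_sum_sq_div hw hcz).trans (mul_le_mul_of_nonneg_left hcs hσ)
    _ = coords U c 0 ^ 2 * (1 + ⨆ i, w i) := by ring

lemma arccos_inner_axis_div_le_iSup_theta (hU : U ∈ Matrix.orthogonalGroup (Fin (n + 1)) ℝ)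
    (hw : ∀ i, 0 ≤ w i) {v : Vec n} (hv : ‖v‖ = 1) :
    Real.arccos (inner ℝ v (axis U) / Real.sqrt (1 + ⨆ i, w i)) ≤
      ⨆ c : ellipsoidalCone w U, theta (c : Vec n) v := by
  obtain ⟨c, hc, hcn, hcv⟩ := exists_mem_ellipsoidalCone_inner_le hU hw v
  have hc0 : c ≠ 0 := by
    rw [← norm_pos_iff, hcn]
    exact one_pos.trans_le (one_le_sqrt_one_add_iSup hw)
  refine le_trans ?_ (theta_le_iSup hc v)
  rw [theta_eq_arccos hc0, hv, mul_one, hcn]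
  exact Real.arccos_le_arccos (div_le_div_of_nonneg_right hcv (Real.sqrt_nonneg _))

lemma aperture_le_iSup_theta (hU : U ∈ Matrix.orthogonalGroup (Fin (n + 1)) ℝ)
    (hw : ∀ i, 0 ≤ w i) {v : Vec n} (hv : ‖v‖ = 1) :
    aperture w ≤ ⨆ c : ellipsoidalCone w U, theta (c : Vec n) v := by
  refine le_trans ?_ (arccos_inner_axis_div_le_iSup_theta hU hw hv)
  refine Real.arccos_le_arccos (div_le_div_of_nonneg_right ?_ (Real.sqrt_nonneg _))
  simpa only [hv, norm_axis hU, one_mul] using real_inner_le_norm v (axis U)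

lemma iSup_theta_axis (hU : U ∈ Matrix.orthogonalGroup (Fin (n + 1)) ℝ) (hw : ∀ i, 0 ≤ w i) :
    ⨆ c : ellipsoidalCone w U, theta (c : Vec n) (axis U) = aperture w := by
  have := (nonempty_ellipsoidalCone hU hw).to_subtype
  exact le_antisymm (ciSup_le fun c => theta_axis_le_aperture hU hw c.2)
    (aperture_le_iSup_theta hU hw (norm_axis hU))

lemma uncertaintyAngle_ellipsoidalCone (hU : U ∈ Matrix.orthogonalGroup (Fin (n + 1)) ℝ)
    (hw : ∀ i, 0 ≤ w i) : uncertaintyAngle (ellipsoidalCone w U) = aperture w := by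
  have : Nonempty (Metric.sphere (0 : Vec n) 1) := ⟨⟨axis U, by simpa using norm_axis hU⟩⟩
  refine le_antisymm ?_ (le_ciInf fun v => aperture_le_iSup_theta hU hw (by simp))
  rw [← iSup_theta_axis hU hw]
  exact uncertaintyAngle_le_iSup_theta _ (norm_axis hU)

lemma aperture_lt_iSup_theta (hU : U ∈ Matrix.orthogonalGroup (Fin (n + 1)) ℝ)
    (hw : ∀ i, 0 ≤ w i) {v : Vec n} (hv : ‖v‖ = 1) (hne : v ≠ axis U) :
    aperture w < ⨆ c : ellipsoidalCone w U, theta (c : Vec n) v := by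
  have hs : 1 ≤ Real.sqrt (1 + ⨆ i, w i) := one_le_sqrt_one_add_iSup hw
  have hs0 : 0 < Real.sqrt (1 + ⨆ i, w i) := one_pos.trans_le hs
  have habs : |inner ℝ v (axis U)| ≤ 1 := by
    simpa only [hv, norm_axis hU, one_mul] using abs_real_inner_le_norm v (axis U)
  have hlt : inner ℝ v (axis U) < (1 : ℝ) :=
    lt_of_le_of_ne (abs_le.1 habs).2 (mt (inner_eq_one_iff_of_norm_eq_one hv (norm_axis hU)).1 hne)
  refine lt_of_lt_of_le ?_ (arccos_inner_axis_div_le_iSup_theta hU hw hv)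
  refine Real.arccos_lt_arccos ?_ (div_lt_div_of_pos_right hlt hs0) ((div_le_one hs0).2 hs)
  rw [le_div_iff₀ hs0]
  linarith [(abs_le.1 habs).1]

lemma isCircumcenter_ellipsoidalCone_iff (hU : U ∈ Matrix.orthogonalGroup (Fin (n + 1)) ℝ)
    (hw : ∀ i, 0 ≤ w i) {v : Vec n} : IsCircumcenter (ellipsoidalCone w U) v ↔ v = axis U := by
  rw [IsCircumcenter, uncertaintyAngle_ellipsoidalCone hU hw]
  constructor
  · rintro ⟨hv, hsup⟩
    by_contra hne
    exact (aperture_lt_iSup_theta hU hw hv hne).ne' hsup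
  · rintro rfl
    exact ⟨norm_axis hU, iSup_theta_axis hU hw⟩

/-! ### Widths and cone updates -/

lemma width_nonneg (hw : ∀ i, 0 ≤ w i) (δ : Vec n) : 0 ≤ width w U δ := by
  rw [width_eq_sum]
  exact Finset.sum_nonneg fun i _ => mul_nonneg (hw i) (sq_nonneg _)

lemma width_le (hU : U ∈ Matrix.orthogonalGroup (Fin (n + 1)) ℝ) {B : ℝ} (hB : 0 ≤ B)
    (hw : ∀ i, w i ≤ B) (δ : Vec n) : width w U δ ≤ B * ‖δ‖ ^ 2 := by
  rw [width_eq_sum]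
  calc ∑ i, w i * coords U δ i.succ ^ 2 ≤ ∑ i : Fin n, B * coords U δ i.succ ^ 2 :=
        Finset.sum_le_sum fun i _ => mul_le_mul_of_nonneg_right (hw i) (sq_nonneg _)
    _ ≤ B * ‖δ‖ ^ 2 := by
        rw [← Finset.mul_sum]
        exact mul_le_mul_of_nonneg_left (sum_sq_coords_succ_le hU δ) hB

lemma inner_le_sum_coords_succ (hU : U ∈ Matrix.orthogonalGroup (Fin (n + 1)) ℝ) {c δ : Vec n}
    (hc : c ∈ ellipsoidalCone w U) (hδ : coords U δ 0 ≤ 0) :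
    inner ℝ δ c ≤ ∑ i : Fin n, coords U δ i.succ * coords U c i.succ := by
  rw [inner_eq_coords hU]
  linarith [mul_nonpos_of_nonpos_of_nonneg hδ hc.1]

lemma sq_inner_le_width (hU : U ∈ Matrix.orthogonalGroup (Fin (n + 1)) ℝ) (hw : ∀ i, 0 ≤ w i)
    {c δ : Vec n} (hc : c ∈ ellipsoidalCone w U) (hcn : ‖c‖ ≤ 1) (hδ : coords U δ 0 ≤ 0)
    (hδc : 0 ≤ inner ℝ δ c) : inner ℝ δ c ^ 2 ≤ width w U δ := by
  have hle := inner_le_sum_coords_succ hU hc hδ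
  obtain ⟨-, hz, hs⟩ := hc
  have hs1 : ∑ i : Fin n, coords U c i.succ ^ 2 / w i ≤ 1 :=
    hs.trans ((sq_coords_zero_le hU c).trans (pow_le_one₀ (norm_nonneg c) hcn))
  calc inner ℝ δ c ^ 2
      ≤ (∑ i : Fin n, coords U δ i.succ * coords U c i.succ) ^ 2 := by gcongr
    _ ≤ (∑ i, w i * coords U δ i.succ ^ 2) * ∑ i : Fin n, coords U c i.succ ^ 2 / w i := by
        refine Finset.sum_sq_le_sum_mul_sum_of_sq_le_mul _
          (fun i _ => mul_nonneg (hw i) (sq_nonneg _))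
          (fun i _ => div_nonneg (sq_nonneg _) (hw i)) fun i _ => ?_
        rcases (hw i).eq_or_lt with h | h
        · rw [hz i h.symm, ← h]
          simp
        · exact le_of_eq (by field_simp)
    _ ≤ width w U δ := by
        rw [← width_eq_sum]
        exact mul_le_of_le_one_right (width_nonneg hw δ) hs1

lemma sum_updB_mul_coords_div_nonneg (hU : U ∈ Matrix.orthogonalGroup (Fin (n + 1)) ℝ)
    (hw : ∀ i, 0 < w i) {c δ : Vec n} (hc : c ∈ ellipsoidalCone w U) (hδ : coords U δ 0 ≤ 0)
    (hδc : 0 ≤ inner ℝ δ c) : 0 ≤ ∑ i, updB w U δ i * coords U c i.succ / w i := by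
  have hterm (i : Fin n) : updB w U δ i * coords U c i.succ / w i =
      (Real.sqrt (width w U δ))⁻¹ * (coords U δ i.succ * coords U c i.succ) := by
    have := (hw i).ne'
    simp only [updB, Pi.smul_apply, Matrix.mulVec_diagonal, smul_eq_mul]
    field_simp
  simp only [hterm]
  rw [← Finset.mul_sum]
  exact mul_nonneg (inv_nonneg.2 (Real.sqrt_nonneg _))
    (hδc.trans (inner_le_sum_coords_succ hU hc hδ))

lemma updN_posSemidef (hw : ∀ i, 0 ≤ w i) (δ : Vec n) : (updN w U δ).PosSemidef := by
  rw [updN_eq_cutMatrix]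
  exact cutMatrix_posSemidef (sq_cutVector_dotProduct_le hw)

namespace ConeUpdate

variable {δ : Vec n} {w' : Fin n → ℝ} {U' : Matrix (Fin (n + 1)) (Fin (n + 1)) ℝ}

lemma orthogonal (h : ConeUpdate w U δ w' U')
    (hU : U ∈ Matrix.orthogonalGroup (Fin (n + 1)) ℝ) :
    U' ∈ Matrix.orthogonalGroup (Fin (n + 1)) ℝ := by
  obtain ⟨-, l, V, -, hV, -, rfl⟩ := h
  exact Submonoid.mul_mem _ hU hV.1

lemma le (h : ConeUpdate w U δ w' U') (hU : U ∈ Matrix.orthogonalGroup (Fin (n + 1)) ℝ)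
    (hδ : ‖δ‖ ≤ 1) (hn : n ≠ 0) {m : ℝ} (hm : 0 ≤ m) (hw : ∀ i, m ≤ w i) (hq : 0 < width w U δ)
    (hmq : 4 * (n : ℝ) ^ 2 * m ≤ width w U δ) (i : Fin n) : m ≤ w' i := by
  obtain ⟨⟨-, Q, hQ⟩, -⟩ := h
  refine hQ.le_eigenvalue (fun v => ?_) i
  have hδ1 : (fun i : Fin n => coords U δ i.succ) ⬝ᵥ (fun i : Fin n => coords U δ i.succ) ≤ 1 := by
    simp only [dotProduct, ← sq]
    exact (sum_sq_coords_succ_le hU δ).trans (pow_le_one₀ (norm_nonneg δ) hδ)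
  rw [updN_eq_cutMatrix]
  rw [width_eq_sum] at hq hmq
  exact le_dotProduct_cutMatrix_mulVec hn hm hw hδ1 hq hmq v

lemma prod_le (h : ConeUpdate w U δ w' U') (hn : n ≠ 0) (hw : ∀ i, 0 < w i)
    (hq : 0 < width w U δ) : ∏ i, w' i ≤ Real.exp (-(1 / (n : ℝ))) * ∏ i, w i := by
  obtain ⟨⟨-, Q, hQ⟩, -⟩ := h
  rw [← hQ.det_eq, updN_eq_cutMatrix]
  rw [width_eq_sum] at hq
  exact det_cutMatrix_le hn hw (sum_cutVector_sq_div hw hq)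

lemma mem (h : ConeUpdate w U δ w' U') (hU : U ∈ Matrix.orthogonalGroup (Fin (n + 1)) ℝ)
    (hn : n ≠ 0) (hw : ∀ i, 0 < w i) (hw' : ∀ i, 0 < w' i) (hq : 0 < width w U δ) {c : Vec n}
    (hc : c ∈ ellipsoidalCone w U) (hδ : coords U δ 0 ≤ 0) (hδc : 0 ≤ inner ℝ δ c) :
    c ∈ ellipsoidalCone w' U' := by
  obtain ⟨⟨hmono, Q, hQ⟩, l, V, hl, hV, hV0, rfl⟩ := h
  have hb : ∑ i, updB w U δ i ^ 2 / w i = 1 := by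
    rw [width_eq_sum] at hq
    rw [updB_eq_cutVector]
    exact sum_cutVector_sq_div hw hq
  have hcut := sum_updB_mul_coords_div_nonneg hU hw hc hδ hδc
  obtain ⟨h0, -, hs⟩ := hc
  obtain ⟨r, hr, hrr⟩ := exists_shift_of_mem_halfEllipsoid (z := Fin.tail (coords U c)) hn hw hb h0
    hs hcut
  have hN_eq : updN w U δ = cutMatrix w (updB w U δ) := rfl
  rw [← hN_eq] at hr hrr
  rw [updM_eq_blockMatrix] at hV
  have hN : (updN w U δ).PosSemidef := updN_posSemidef (fun i => (hw i).le) δ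
  refine ⟨?_, fun i hi => absurd hi (hw' i).ne', ?_⟩ <;> simp only [coords_mul]
  · exact eigencoordinate_zero_nonneg hV hl hV0 hN h0 hr hrr
  · exact sum_sq_eigencoordinate_div_le hV hl hN hQ hmono hw' hr hrr

end ConeUpdate

end Coords

/-! ### Regret of a run -/

section Regret

variable {n m T : ℕ} {C₀ : Set (Vec n)} {cstar : Vec n} {X : ℕ → Set (EuclideanSpace ℝ (Fin m))}
  {f : ℕ → EuclideanSpace ℝ (Fin m) → Vec n} {xstar x : ℕ → EuclideanSpace ℝ (Fin m)}
  {c : ℕ → Vec n} {w : ℕ → Fin n → ℝ} {U : ℕ → Matrix (Fin (n + 1)) (Fin (n + 1)) ℝ} {ε : ℝ}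

section Period

variable {Y : Set (EuclideanSpace ℝ (Fin m))} {φ : EuclideanSpace ℝ (Fin m) → Vec n}
  {y z : EuclideanSpace ℝ (Fin m)} {v : Vec n}

lemma norm_effectiveDiff_le_one (φ : EuclideanSpace ℝ (Fin m) → Vec n)
    (y z : EuclideanSpace ℝ (Fin m)) : ‖effectiveDiff φ y z‖ ≤ 1 := by
  rw [effectiveDiff, norm_smul, norm_inv, norm_norm]
  exact inv_mul_le_one

lemma norm_smul_effectiveDiff (φ : EuclideanSpace ℝ (Fin m) → Vec n)
    (y z : EuclideanSpace ℝ (Fin m)) : ‖φ y - φ z‖ • effectiveDiff φ y z = φ y - φ z := by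
  rcases eq_or_ne (φ y - φ z) 0 with h | h
  · rw [h, norm_zero, zero_smul]
  · rw [effectiveDiff, smul_inv_smul₀ (norm_ne_zero_iff.2 h)]

lemma inner_effectiveDiff_nonpos (hy : y ∈ argmins v Y φ) (hz : z ∈ Y) :
    inner ℝ (effectiveDiff φ y z) v ≤ 0 := by
  rw [effectiveDiff, real_inner_smul_left, inner_sub_left]
  exact mul_nonpos_of_nonneg_of_nonpos (by positivity) (sub_nonpos.2 (hy.2 z hz))

lemma inner_effectiveDiff_nonneg (hz : z ∈ argmins v Y φ) (hy : y ∈ Y) :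
    0 ≤ inner ℝ (effectiveDiff φ y z) v := by
  rw [effectiveDiff, real_inner_smul_left, inner_sub_left]
  exact mul_nonneg (by positivity) (sub_nonneg.2 (hz.2 y hy))

lemma inner_sub_le_one (hnorm : ‖φ y - φ z‖ ≤ 1) (hv : ‖v‖ ≤ 1) :
    inner ℝ (φ y - φ z) v ≤ 1 :=
  (real_inner_le_norm _ _).trans (mul_le_one₀ hnorm (norm_nonneg v) hv)

lemma inner_sub_le_sqrt_width {O : Matrix (Fin (n + 1)) (Fin (n + 1)) ℝ} {W : Fin n → ℝ}
    (hO : O ∈ Matrix.orthogonalGroup (Fin (n + 1)) ℝ) (hW : ∀ i, 0 ≤ W i)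
    (hmem : v ∈ ellipsoidalCone W O) (hv : ‖v‖ ≤ 1) (hnorm : ‖φ y - φ z‖ ≤ 1)
    (hy : y ∈ argmins (axis O) Y φ) (hz : z ∈ argmins v Y φ) :
    inner ℝ (φ y - φ z) v ≤ Real.sqrt (width W O (effectiveDiff φ y z)) := by
  have hδ : coords O (effectiveDiff φ y z) 0 ≤ 0 := by
    rw [coords_zero]
    exact inner_effectiveDiff_nonpos hy hz.1
  have hδv : 0 ≤ inner ℝ (effectiveDiff φ y z) v := inner_effectiveDiff_nonneg hz hy.1
  rw [← norm_smul_effectiveDiff, real_inner_smul_left]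
  exact (mul_le_of_le_one_left hδv hnorm).trans
    (Real.le_sqrt_of_sq_le (sq_inner_le_width hO hW hmem hv hδ hδv))

end Period

lemma Admissible.norm_sub_le_one (hX : Admissible T X f) {t : ℕ} (ht : t < T)
    {y z : EuclideanSpace ℝ (Fin m)} (hy : y ∈ X t) (hz : z ∈ X t) : ‖f t y - f t z‖ ≤ 1 := by
  obtain ⟨-, hdiam, hlip⟩ := hX t ht
  rw [← dist_eq_norm]
  exact (hlip.dist_le_mul y hy z hz).trans (by simpa using hdiam y hy z hz)

lemma IsRun.action_axis (hrun : IsRun ε C₀ T X f xstar x c w U) {t : ℕ} (ht : t < T)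
    (hU : U t ∈ Matrix.orthogonalGroup (Fin (n + 1)) ℝ) (hw : ∀ i, 0 ≤ w t i) :
    x t ∈ argmins (axis (U t)) (X t) (f t) := by
  rw [← (isCircumcenter_ellipsoidalCone_iff hU hw).1 (hrun.proxy t ht)]
  exact hrun.action t ht

lemma IsRun.mem_start (hrun : IsRun ε C₀ T X f xstar x c w U)
    (hα : uncertaintyAngle C₀ < Real.pi / 2) (hcs : cstar ∈ C₀) :
    cstar ∈ ellipsoidalCone (w 0) (U 0) := by
  rw [funext hrun.start_width]
  exact mem_ellipsoidalCone_of_theta_le hrun.start_orthogonal hα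
    (hrun.start_axis.2 ▸ theta_le_iSup hcs (axis (U 0)))

/-- The periods before `t` in which the cone is updated. -/
def updatePeriods (ε : ℝ) (f : ℕ → EuclideanSpace ℝ (Fin m) → Vec n)
    (xstar x : ℕ → EuclideanSpace ℝ (Fin m)) (w : ℕ → Fin n → ℝ)
    (U : ℕ → Matrix (Fin (n + 1)) (Fin (n + 1)) ℝ) (t : ℕ) : Finset ℕ :=
  open Classical in
  {r ∈ Finset.range t | ε ^ 2 < width (w r) (U r) (effectiveDiff (f r) (x r) (xstar r))}

lemma updatePeriods_zero : updatePeriods ε f xstar x w U 0 = ∅ := rfl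

lemma card_updatePeriods_succ_of_lt {t : ℕ}
    (h : ε ^ 2 < width (w t) (U t) (effectiveDiff (f t) (x t) (xstar t))) :
    (updatePeriods ε f xstar x w U (t + 1)).card = (updatePeriods ε f xstar x w U t).card + 1 := by
  rw [updatePeriods, Finset.range_add_one, Finset.filter_insert, if_pos h,
    Finset.card_insert_of_notMem (by simp)]
  rfl

lemma updatePeriods_succ_of_le {t : ℕ}
    (h : width (w t) (U t) (effectiveDiff (f t) (x t) (xstar t)) ≤ ε ^ 2) :
    updatePeriods ε f xstar x w U (t + 1) = updatePeriods ε f xstar x w U t := by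
  rw [updatePeriods, Finset.range_add_one, Finset.filter_insert, if_neg (not_lt.2 h)]
  rfl

namespace IsRun

lemma regret_le_card_updatePeriods_add (hrun : IsRun ε C₀ T X f xstar x c w U) (hε : 0 ≤ ε)
    (hX : Admissible T X f) (hcn : ‖cstar‖ ≤ 1)
    (hstar : ∀ t < T, xstar t ∈ argmins cstar (X t) (f t))
    (hinv : ∀ t < T, U t ∈ Matrix.orthogonalGroup (Fin (n + 1)) ℝ ∧ (∀ i, 0 ≤ w t i) ∧
      cstar ∈ ellipsoidalCone (w t) (U t)) :
    regret T cstar f x xstar ≤ (updatePeriods ε f xstar x w U T).card + T * ε := by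
  classical
  have hperiod : ∀ t ∈ Finset.range T, inner ℝ (f t (x t) - f t (xstar t)) cstar ≤
      (if ε ^ 2 < width (w t) (U t) (effectiveDiff (f t) (x t) (xstar t)) then 1 else 0) + ε := by
    intro t ht
    have htT := Finset.mem_range.1 ht
    obtain ⟨hU, hw, hmem⟩ := hinv t htT
    have hact := hrun.action_axis htT hU hw
    have hnorm := hX.norm_sub_le_one htT hact.1 (hstar t htT).1
    split_ifs with h
    · exact (inner_sub_le_one hnorm hcn).trans (le_add_of_nonneg_right hε)
    · rw [zero_add]
      exact (inner_sub_le_sqrt_width hU hw hmem hcn hnorm hact (hstar t htT)).trans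
        (Real.sqrt_le_iff.2 ⟨hε, not_lt.1 h⟩)
  refine (Finset.sum_le_sum hperiod).trans (le_of_eq ?_)
  rw [Finset.sum_add_distrib, Finset.sum_boole, Finset.sum_const, Finset.card_range, nsmul_eq_mul,
    updatePeriods]

lemma invariants (hrun : IsRun ε C₀ T X f xstar x c w U)
    (hα : uncertaintyAngle C₀ < Real.pi / 2) (hcs : cstar ∈ C₀)
    (hstar : ∀ t < T, xstar t ∈ argmins cstar (X t) (f t)) (hn : n ≠ 0) {μ : ℝ} (hμ : 0 < μ)
    (hμε : 4 * (n : ℝ) ^ 2 * μ ≤ ε ^ 2) (hμα : μ ≤ Real.tan (uncertaintyAngle C₀) ^ 2) {t : ℕ}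
    (ht : t ≤ T) :
    U t ∈ Matrix.orthogonalGroup (Fin (n + 1)) ℝ ∧ (∀ i, μ ≤ w t i) ∧
      cstar ∈ ellipsoidalCone (w t) (U t) ∧
      ∏ i, w t i ≤ Real.exp (-((updatePeriods ε f xstar x w U t).card / (n : ℝ))) *
        (Real.tan (uncertaintyAngle C₀) ^ 2) ^ n := by
  induction t with
  | zero =>
    refine ⟨hrun.start_orthogonal, fun i => hμα.trans_eq (hrun.start_width i).symm,
      hrun.mem_start hα hcs, ?_⟩
    simp [updatePeriods_zero, hrun.start_width]
  | succ t ih =>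
    obtain ⟨hU, hw, hmem, hprod⟩ := ih (Nat.le_of_succ_le ht)
    rcases le_or_gt (width (w t) (U t) (effectiveDiff (f t) (x t) (xstar t))) (ε ^ 2) with h | h
    · obtain ⟨hw_eq, hU_eq⟩ := hrun.no_update t ht h
      rw [updatePeriods_succ_of_le h, hw_eq, hU_eq]
      exact ⟨hU, hw, hmem, hprod⟩
    · have hupd := hrun.cone_update t ht h
      have hq : 0 < width (w t) (U t) (effectiveDiff (f t) (x t) (xstar t)) :=
        (sq_nonneg ε).trans_lt h
      have hw_pos (i : Fin n) : 0 < w t i := hμ.trans_le (hw i)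
      have hact := hrun.action_axis ht hU fun i => (hw_pos i).le
      have hδ : coords (U t) (effectiveDiff (f t) (x t) (xstar t)) 0 ≤ 0 :=
        (coords_zero _ _).trans_le (inner_effectiveDiff_nonpos hact (hstar t ht).1)
      have hw' := hupd.le hU (norm_effectiveDiff_le_one _ _ _) hn hμ.le hw hq (hμε.trans h.le)
      refine ⟨hupd.orthogonal hU, hw', hupd.mem hU hn hw_pos (fun i => hμ.trans_le (hw' i)) hq hmem
        hδ (inner_effectiveDiff_nonneg (hstar t ht) hact.1), (hupd.prod_le hn hw_pos hq).trans ?_⟩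
      rw [card_updatePeriods_succ_of_lt h, Nat.cast_add, Nat.cast_one, add_div, neg_add,
        Real.exp_add, mul_comm (Real.exp _) (Real.exp _), mul_assoc]
      exact mul_le_mul_of_nonneg_left hprod (Real.exp_pos _).le

lemma constant (hrun : IsRun ε C₀ T X f xstar x c w U)
    (hαε : n = 0 ∨ Real.tan (uncertaintyAngle C₀) ^ 2 ≤ ε ^ 2) {t : ℕ} (ht : t ≤ T) :
    w t = w 0 ∧ U t = U 0 ∧ updatePeriods ε f xstar x w U t = ∅ := by
  induction t with
  | zero => exact ⟨rfl, rfl, updatePeriods_zero⟩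
  | succ t ih =>
    obtain ⟨hw, hU, hempty⟩ := ih (Nat.le_of_succ_le ht)
    have hwε (i : Fin n) : w 0 i ≤ ε ^ 2 := by
      rcases hαε with rfl | h
      · exact i.elim0
      · rwa [hrun.start_width]
    have h : width (w t) (U t) (effectiveDiff (f t) (x t) (xstar t)) ≤ ε ^ 2 := by
      rw [hw, hU]
      exact (width_le hrun.start_orthogonal (sq_nonneg ε) hwε _).trans (mul_le_of_le_one_right
        (sq_nonneg ε) (pow_le_one₀ (norm_nonneg _) (norm_effectiveDiff_le_one _ _ _)))
    obtain ⟨hw_eq, hU_eq⟩ := hrun.no_update t ht h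
    rw [updatePeriods_succ_of_le h, hw_eq, hU_eq]
    exact ⟨hw, hU, hempty⟩

end IsRun

lemma tan_uncertaintyAngle_nonneg (hα : uncertaintyAngle C₀ < Real.pi / 2) :
    0 ≤ Real.tan (uncertaintyAngle C₀) :=
  Real.tan_nonneg_of_nonneg_of_le_pi_div_two (uncertaintyAngle_nonneg C₀) hα.le

lemma le_log_of_pow_le_exp_mul_pow {μ ρ k : ℝ} (hμ : 0 < μ) (hρ : 0 < ρ) (hn : n ≠ 0)
    (h : μ ^ n ≤ Real.exp (-(k / n)) * (ρ ^ 2 * μ) ^ n) : k ≤ 2 * (n : ℝ) ^ 2 * Real.log ρ := by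
  have hn0 : (0 : ℝ) < n := by positivity
  have hexp : Real.exp (k / n) ≤ ρ ^ (2 * n) := by
    rw [Real.exp_neg, le_inv_mul_iff₀ (Real.exp_pos _), mul_pow, ← pow_mul] at h
    exact le_of_mul_le_mul_right h (pow_pos hμ n)
  have hlog := (Real.le_log_iff_exp_le (by positivity)).2 hexp
  rw [Real.log_pow, div_le_iff₀ hn0] at hlog
  push_cast at hlog
  linarith

namespace IsRun

lemma regret_le_of_no_update (hrun : IsRun ε C₀ T X f xstar x c w U) (hε : 0 ≤ ε)
    (hα : uncertaintyAngle C₀ < Real.pi / 2) (hX : Admissible T X f) (hcs : cstar ∈ C₀)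
    (hcn : ‖cstar‖ ≤ 1) (hstar : ∀ t < T, xstar t ∈ argmins cstar (X t) (f t))
    (hαε : n = 0 ∨ Real.tan (uncertaintyAngle C₀) ^ 2 ≤ ε ^ 2) :
    regret T cstar f x xstar ≤ T * ε := by
  have hreg := hrun.regret_le_card_updatePeriods_add hε hX hcn hstar fun t ht => by
    obtain ⟨hw, hU, -⟩ := hrun.constant hαε ht.le
    rw [hw, hU]
    exact ⟨hrun.start_orthogonal, fun i => by rw [hrun.start_width]; positivity,
      hrun.mem_start hα hcs⟩
  rwa [(hrun.constant hαε le_rfl).2.2, Finset.card_empty, Nat.cast_zero, zero_add] at hreg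

lemma regret_le_of_lt (hrun : IsRun ε C₀ T X f xstar x c w U) (hε : 0 < ε)
    (hα : uncertaintyAngle C₀ < Real.pi / 2) (hX : Admissible T X f) (hcs : cstar ∈ C₀)
    (hcn : ‖cstar‖ ≤ 1) (hstar : ∀ t < T, xstar t ∈ argmins cstar (X t) (f t)) (hn : n ≠ 0)
    (hεα : ε < Real.tan (uncertaintyAngle C₀)) :
    regret T cstar f x xstar ≤
      2 * (n : ℝ) ^ 2 * Real.log (2 * n * Real.tan (uncertaintyAngle C₀) / ε) + T * ε := by
  set τ := Real.tan (uncertaintyAngle C₀)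
  have hn1 : (1 : ℝ) ≤ n := mod_cast Nat.one_le_iff_ne_zero.2 hn
  have hτ : 0 < τ := hε.trans hεα
  set μ : ℝ := ε ^ 2 / (4 * n ^ 2)
  have hμ : 0 < μ := by positivity
  have hμε : 4 * (n : ℝ) ^ 2 * μ = ε ^ 2 := mul_div_cancel₀ _ (by positivity)
  have hμτ : μ ≤ τ ^ 2 :=
    (div_le_self (sq_nonneg ε) (by nlinarith)).trans (pow_le_pow_left₀ hε.le hεα.le 2)
  have hinv (t : ℕ) (ht : t ≤ T) := hrun.invariants hα hcs hstar hn hμ hμε.le hμτ ht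
  have hreg := hrun.regret_le_card_updatePeriods_add hε.le hX hcn hstar fun t ht =>
    ⟨(hinv t ht.le).1, fun i => hμ.le.trans ((hinv t ht.le).2.1 i), (hinv t ht.le).2.2.1⟩
  obtain ⟨-, hwT, -, hprod⟩ := hinv T le_rfl
  have hμ_prod : μ ^ n ≤ ∏ i, w T i := by
    simpa using Finset.prod_le_prod (s := Finset.univ) (fun _ _ => hμ.le) fun i _ => hwT i
  have hτ_eq : τ ^ 2 = (2 * n * τ / ε) ^ 2 * μ := by
    simp only [μ]
    field_simp
    norm_num
  refine hreg.trans (add_le_add_left (le_log_of_pow_le_exp_mul_pow hμ (by positivity) hn ?_) _)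
  rw [← hτ_eq]
  exact hμ_prod.trans hprod

theorem regret_le (hrun : IsRun ε C₀ T X f xstar x c w U) (hε : 0 < ε)
    (hα : uncertaintyAngle C₀ < Real.pi / 2) (hX : Admissible T X f) (hcs : cstar ∈ C₀)
    (hcn : ‖cstar‖ ≤ 1) (hstar : ∀ t < T, xstar t ∈ argmins cstar (X t) (f t)) :
    regret T cstar f x xstar ≤ 2 * (n : ℝ) ^ 2 *
      max 0 (Real.log (2 * n * Real.tan (uncertaintyAngle C₀) / ε)) + T * ε := by
  by_cases hαε : n = 0 ∨ Real.tan (uncertaintyAngle C₀) ^ 2 ≤ ε ^ 2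
  · exact (hrun.regret_le_of_no_update hε.le hα hX hcs hcn hstar hαε).trans
      (le_add_of_nonneg_left (by positivity))
  · push Not at hαε
    have hεα := lt_of_pow_lt_pow_left₀ 2 (tan_uncertaintyAngle_nonneg hα) hαε.2
    refine (hrun.regret_le_of_lt hε hα hX hcs hcn hstar hαε.1 hεα).trans ?_
    gcongr
    exact le_max_right _ _

end IsRun

end Regret

lemma log_two_mul_div_le {n T : ℕ} {τ : ℝ} (hτ : 0 ≤ τ) :
    max 0 (Real.log (2 * n * τ / (((n + 1 : ℕ) : ℝ) / T))) ≤
      max 0 (Real.log (10 * (T : ℝ) * τ)) := by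
  have hle : 2 * n * τ / (((n + 1 : ℕ) : ℝ) / T) ≤ 10 * (T : ℝ) * τ := by
    have hτT : 0 ≤ τ * T := by positivity
    rw [div_div_eq_mul_div, div_le_iff₀ (by positivity)]
    push_cast
    nlinarith [mul_nonneg hτT (Nat.cast_nonneg (α := ℝ) n)]
  rcases (show 0 ≤ 2 * n * τ / (((n + 1 : ℕ) : ℝ) / T) by positivity).eq_or_lt with h | h
  · rw [← h, Real.log_zero, max_self]
    exact le_max_left _ _
  · exact max_le_max_left 0 (Real.log_le_log h hle)

lemma regretBound_le {n T : ℕ} (hT : 1 ≤ T) {τ : ℝ} (hτ : 0 ≤ τ) :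
    2 * (n : ℝ) ^ 2 * max 0 (Real.log (2 * n * τ / (((n + 1 : ℕ) : ℝ) / T))) +
        T * (((n + 1 : ℕ) : ℝ) / T) ≤
      2 * (n : ℝ) ^ 2 * max 0 (Real.log (10 * (T : ℝ) * τ)) + ((n + 1 : ℕ) : ℝ) := by
  rw [mul_div_cancel₀ _ (Nat.cast_ne_zero.2 (Nat.one_le_iff_ne_zero.1 hT))]
  exact add_le_add_left (mul_le_mul_of_nonneg_left (log_two_mul_div_le hτ) (by positivity)) _

/-! ### Polynomial step bounds -/

section Cost

open MvPolynomial

/-- All bounds of sums are at most the value of the index variable `0`, which no sum rebinds. -/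
def RExpr.Tame : RExpr → Prop
  | .get _ _ _ => True
  | .cast _ => True
  | .plus p q => p.Tame ∧ q.Tame
  | .minus p q => p.Tame ∧ q.Tame
  | .times p q => p.Tame ∧ q.Tame
  | .over p q => p.Tame ∧ q.Tame
  | .root p => p.Tame
  | .sum v k e => v ≠ 0 ∧ (∀ ix, k.eval ix ≤ ix 0) ∧ e.Tame
  | .cond p q r s => p.Tame ∧ q.Tame ∧ r.Tame ∧ s.Tame

/-- A bound on the number of steps of a tame expression, as a polynomial in the value of the index
variable `0`. The second variable, for the horizon, occurs only in `OnlineProgram.cost`. -/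
def RExpr.cost : RExpr → MvPolynomial (Fin 2) ℕ
  | .get _ i j => C (i.steps + j.steps + 1)
  | .cast i => C (i.steps + 1)
  | .plus p q => p.cost + q.cost + 1
  | .minus p q => p.cost + q.cost + 1
  | .times p q => p.cost + q.cost + 1
  | .over p q => p.cost + q.cost + 1
  | .root p => p.cost + 1
  | .sum _ k e => C (k.steps + 1) + X 0 * (e.cost + 2)
  | .cond p q r s => p.cost + q.cost + 1 + (r.cost + s.cost)

/-- Loop-free commands in which block sizes and bounds of sums are at most the value of the index
variable `0`, which is not rebound. The number of columns of a block only has to satisfy this if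
that value is positive, so that column vectors are allowed. -/
def Cmd.Tame : Cmd → Prop
  | .skip => True
  | .fill _ u v k l e => u ≠ 0 ∧ v ≠ 0 ∧ (∀ ix, k.eval ix ≤ ix 0) ∧
      (∀ ix, 0 < ix 0 → l.eval ix ≤ ix 0) ∧ e.Tame
  | .seq p q => p.Tame ∧ q.Tame
  | .cond p q r s => p.Tame ∧ q.Tame ∧ r.Tame ∧ s.Tame
  | .loop _ _ _ => False
  | .eig _ k _ _ => ∀ ix, k.eval ix ≤ ix 0

/-- A bound on the number of steps of a tame command, as a polynomial in the value of the index
variable `0`; the value on loops, which are not tame, is junk. -/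
def Cmd.cost (κ : ℕ) : Cmd → MvPolynomial (Fin 2) ℕ
  | .skip => 0
  | .fill _ _ _ k l e => C (k.steps + l.steps + 1) + X 0 * (1 + X 0 * (e.cost + 2))
  | .seq p q => p.cost κ + q.cost κ
  | .cond p q r s => p.cost + q.cost + 1 + (r.cost κ + s.cost κ)
  | .loop _ _ _ => 0
  | .eig _ k _ _ => C k.steps + C κ * X 0 ^ 3 + 1

/-- A bound on the number of steps of an online program with tame commands, as a polynomial in
the dimension (variable `0`) and the horizon (variable `1`). -/
def OnlineProgram.cost (κ : ℕ) (p : OnlineProgram) : MvPolynomial (Fin 2) ℕ :=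
  p.start.cost κ + X 1 * (3 * X 0 + 1 + p.step.cost κ)

lemma sum_range_le_mul {k D B : ℕ} {f : ℕ → ℕ} (hk : k ≤ D) (hf : ∀ i, f i ≤ B) :
    ∑ i ∈ Finset.range k, f i ≤ D * B :=
  calc ∑ i ∈ Finset.range k, f i ≤ (Finset.range k).card • B :=
        Finset.sum_le_card_nsmul _ _ _ fun i _ => hf i
    _ ≤ D * B := by
        rw [Finset.card_range, smul_eq_mul]
        exact Nat.mul_le_mul_right B hk

lemma RExpr.steps_le_cost (mem : ℕ → ℕ → ℕ → ℝ) (T : ℕ) (e : RExpr) (ix : ℕ → ℕ)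
    (he : e.Tame) : e.steps mem ix ≤ MvPolynomial.eval ![ix 0, T] e.cost := by
  induction e generalizing ix with
  | get | cast => simp only [RExpr.steps, RExpr.cost, eval_C, le_refl]
  | root p ihp =>
    simp only [RExpr.steps, RExpr.cost, map_add, map_one]
    exact Nat.add_le_add_right (ihp ix he) 1
  | sum v k e ihe =>
    obtain ⟨hv, hk, he⟩ := he
    simp only [RExpr.steps, RExpr.cost, map_add, map_mul, eval_C, eval_X, map_ofNat,
      Matrix.cons_val_zero]
    refine Nat.add_le_add_left (sum_range_le_mul (hk ix) fun r => ?_) _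
    have hr := ihe (Function.update ix v r) he
    rw [Function.update_of_ne hv.symm] at hr
    exact Nat.add_le_add_right hr 2
  | cond p q r s ihp ihq ihr ihs =>
    have hp := ihp ix he.1
    have hq := ihq ix he.2.1
    have hr := ihr ix he.2.2.1
    have hs := ihs ix he.2.2.2
    simp only [RExpr.steps, RExpr.cost, map_add, map_one]
    split_ifs <;> lia
  | _ p q ihp ihq =>
    have hp := ihp ix he.1
    have hq := ihq ix he.2
    simp only [RExpr.steps, RExpr.cost, map_add, map_one]
    lia

lemma Cmd.exec_ix (S : Solver) (κ : ℕ) (p : Cmd) (s : State) (hp : p.Tame) :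
    (p.exec S κ s).ix = s.ix := by
  induction p generalizing s with
  | skip | fill | eig => rfl
  | seq p q ihp ihq => rw [Cmd.exec, ihq _ hp.2, ihp _ hp.1]
  | cond p q r t ihr iht =>
    rw [Cmd.exec]
    split_ifs
    · rw [ihr _ hp.2.2.1]
    · rw [iht _ hp.2.2.2]
  | loop => exact hp.elim

lemma Cmd.exec_fill_steps_le (S : Solver) (κ T : ℕ) {a u v : ℕ} {k l : IExpr} {e : RExpr}
    {s : State} (hs : 0 < s.ix 0) (h : (Cmd.fill a u v k l e).Tame) :
    ((Cmd.fill a u v k l e).exec S κ s).steps ≤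
      s.steps + eval ![s.ix 0, T] ((Cmd.fill a u v k l e).cost κ) := by
  obtain ⟨hu, hv, hk, hl, he⟩ := h
  have hentry (i j : ℕ) :
      e.steps s.mem (Function.update (Function.update s.ix u i) v j) + 2 ≤
        eval ![s.ix 0, T] e.cost + 2 := by
    have h := e.steps_le_cost s.mem T (Function.update (Function.update s.ix u i) v j) he
    rw [Function.update_of_ne hv.symm, Function.update_of_ne hu.symm] at h
    exact Nat.add_le_add_right h 2
  have hblock := sum_range_le_mul (hk s.ix) fun i =>
    Nat.add_le_add_left (sum_range_le_mul (hl s.ix hs) (hentry i)) 1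
  simp only [Cmd.exec, Cmd.cost, map_add, map_mul, eval_C, eval_X, map_ofNat, map_one,
    Matrix.cons_val_zero]
  lia

lemma Cmd.exec_steps_le (S : Solver) (κ T : ℕ) (p : Cmd) (s : State) (hp : p.Tame)
    (hs : 0 < s.ix 0) :
    (p.exec S κ s).steps ≤ s.steps + eval ![s.ix 0, T] (p.cost κ) := by
  induction p generalizing s with
  | skip => exact Nat.le_add_right _ _
  | fill => exact Cmd.exec_fill_steps_le S κ T hs hp
  | seq p q ihp ihq =>
    have hix := Cmd.exec_ix S κ p s hp.1
    have h₁ := ihp s hp.1 hs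
    have h₂ := ihq (p.exec S κ s) hp.2 (hix ▸ hs)
    rw [hix] at h₂
    simp only [Cmd.exec, Cmd.cost, map_add]
    lia
  | cond p q r t ihr iht =>
    have h₁ := p.steps_le_cost s.mem T s.ix hp.1
    have h₂ := q.steps_le_cost s.mem T s.ix hp.2.1
    simp only [Cmd.exec, Cmd.cost, map_add, map_one]
    split_ifs
    · refine Nat.le_trans (ihr _ hp.2.2.1 ?_) ?_
      · exact hs
      · dsimp only
        lia
    · refine Nat.le_trans (iht _ hp.2.2.2 ?_) ?_
      · exact hs
      · dsimp only
        lia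
  | loop => exact hp.elim
  | eig a k l q =>
    have hk : κ * k.eval s.ix ^ 3 ≤ κ * s.ix 0 ^ 3 :=
      Nat.mul_le_mul_left κ (Nat.pow_le_pow_left (hp s.ix) 3)
    simp only [Cmd.exec, Cmd.cost, map_add, map_mul, map_pow, eval_C, eval_X, map_one,
      Matrix.cons_val_zero]
    lia

namespace OnlineProgram

variable (p : OnlineProgram) (S : Solver) (κ : ℕ) {n : ℕ} (T : ℕ) (c₀ : Vec n) (τ : ℝ)
  (g h : ℕ → Vec n)

lemma run_ix (hs : p.start.Tame) (hp : p.step.Tame) (t : ℕ) :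
    (p.run S κ T c₀ τ g h t).ix = (inputState n T c₀ τ).ix := by
  induction t with
  | zero => exact Cmd.exec_ix S κ _ _ hs
  | succ t ih => exact (Cmd.exec_ix S κ _ _ hp).trans ih

lemma run_steps_le_add_mul (hs : p.start.Tame) (hp : p.step.Tame) (t : ℕ) :
    (p.run S κ T c₀ τ g h t).steps ≤ eval ![n + 1, T] (p.start.cost κ) +
      t * (3 * (n + 1) + 1 + eval ![n + 1, T] (p.step.cost κ)) := by
  induction t with
  | zero =>
    have hstart : (p.start.exec S κ (inputState n T c₀ τ)).steps ≤
        0 + eval ![n + 1, T] (p.start.cost κ) :=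
      Cmd.exec_steps_le S κ T p.start (inputState n T c₀ τ) hs n.succ_pos
    rw [Nat.zero_add] at hstart
    rwa [run, Nat.zero_mul, Nat.add_zero]
  | succ t ih =>
    have hix : ((p.run S κ T c₀ τ g h t).receive (g t) (h t)).ix 0 = n + 1 :=
      congrFun (p.run_ix S κ T c₀ τ g h hs hp t) 0
    have hstep := Cmd.exec_steps_le S κ T p.step _ hp (n.succ_pos.trans_eq hix.symm)
    rw [hix, State.receive] at hstep
    rw [run, State.receive, Nat.succ_mul]
    lia

lemma run_steps_le (hs : p.start.Tame) (hp : p.step.Tame) :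
    (p.run S κ T c₀ τ g h T).steps ≤ eval ![n + 1, T] (p.cost κ) := by
  simpa only [cost, map_add, map_mul, map_ofNat, map_one, eval_X, Matrix.cons_val_zero,
    Matrix.cons_val_one] using p.run_steps_le_add_mul S κ T c₀ τ g h hs hp T

end OnlineProgram

end Cost

/-! ### Memory after a command -/

/-- The first `k` entries of column `0` of array `a`. -/
def State.vec (s : State) (a k : ℕ) : Fin k → ℝ := fun i => s.mem a i 0

/-- The `k × k` block of array `a`. -/
def State.block (s : State) (a k : ℕ) : Matrix (Fin k) (Fin k) ℝ :=
  Matrix.of fun i j => s.mem a i j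

section Memory

variable {S : Solver} {κ : ℕ} {s : State} {a k : ℕ}

lemma setBlock_same {mem : ℕ → ℕ → ℕ → ℝ} {l i j : ℕ} {g : ℕ → ℕ → ℝ} (hi : i < k)
    (hj : j < l) : setBlock mem a k l g a i j = g i j := by
  rw [setBlock, Function.update_self, if_pos ⟨hi, hj⟩]

lemma setBlock_of_col {mem : ℕ → ℕ → ℕ → ℝ} {l i j : ℕ} {g : ℕ → ℕ → ℝ} (hj : l ≤ j) :
    setBlock mem a k l g a i j = mem a i j := by
  rw [setBlock, Function.update_self, if_neg fun h => h.2.not_ge hj]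

lemma setBlock_of_ne {mem : ℕ → ℕ → ℕ → ℝ} {b l : ℕ} {g : ℕ → ℕ → ℝ} (h : b ≠ a) :
    setBlock mem a k l g b = mem b :=
  Function.update_of_ne h _ _

lemma State.vec_congr {s' : State} (h : s'.mem a = s.mem a) : s'.vec a k = s.vec a k :=
  funext fun i => congrFun₂ h i 0

lemma State.block_congr {s' : State} (h : s'.mem a = s.mem a) :
    s'.block a k = s.block a k :=
  Matrix.ext fun i j => congrFun₂ h i j

lemma exec_seq (p q : Cmd) : (Cmd.seq p q).exec S κ s = q.exec S κ (p.exec S κ s) := rfl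

section Fill

variable {b u v : ℕ} {h w : IExpr} {e : RExpr}

lemma vec_exec_fill (hk : h.eval s.ix = k) :
    ((Cmd.fill a u v h (.lit 1) e).exec S κ s).vec a k =
      fun i : Fin k => e.eval s.mem (Function.update (Function.update s.ix u i) v 0) :=
  funext fun i => setBlock_same (i.is_lt.trans_eq hk.symm) one_pos

lemma block_exec_fill (hk : h.eval s.ix = k) (hk' : w.eval s.ix = k) :
    ((Cmd.fill a u v h w e).exec S κ s).block a k =
      Matrix.of fun i j : Fin k =>
        e.eval s.mem (Function.update (Function.update s.ix u i) v j) :=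
  Matrix.ext fun i j => setBlock_same (i.is_lt.trans_eq hk.symm) (j.is_lt.trans_eq hk'.symm)

lemma block_exec_fill_col {n : ℕ} (hn : h.eval s.ix = n + 1) :
    ((Cmd.fill a u v h (.lit 1) e).exec S κ s).block a (n + 1) =
      (s.block a (n + 1)).updateCol 0
        fun i => e.eval s.mem (Function.update (Function.update s.ix u i) v 0) := by
  refine Matrix.ext fun i => Fin.cases ?_ fun j => ?_
  · rw [Matrix.updateCol_self]
    exact setBlock_same (i.is_lt.trans_eq hn.symm) one_pos
  · rw [Matrix.updateCol_ne j.succ_ne_zero]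
    exact setBlock_of_col (Nat.le_add_left 1 j)

lemma vec_exec_fill_of_ne (hb : b ≠ a) :
    ((Cmd.fill a u v h w e).exec S κ s).vec b k = s.vec b k :=
  State.vec_congr (setBlock_of_ne hb)

lemma block_exec_fill_of_ne (hb : b ≠ a) :
    ((Cmd.fill a u v h w e).exec S κ s).block b k = s.block b k :=
  State.block_congr (setBlock_of_ne hb)

end Fill

section Eig

variable {b l q : ℕ} {h : IExpr}

lemma vec_exec_eig (hk : h.eval s.ix = k) (hlq : l ≠ q) :
    ((Cmd.eig a h l q).exec S κ s).vec l k = (S k (s.block a k)).1 := by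
  subst hk
  exact funext fun i => (congrFun₂ (setBlock_of_ne hlq) i 0).trans <|
    (setBlock_same i.is_lt one_pos).trans (dif_pos i.is_lt)

lemma block_exec_eig (hk : h.eval s.ix = k) :
    ((Cmd.eig a h l q).exec S κ s).block q k = (S k (s.block a k)).2 := by
  subst hk
  exact Matrix.ext fun i j => (setBlock_same i.is_lt j.is_lt).trans (dif_pos ⟨i.is_lt, j.is_lt⟩)

lemma mem_exec_eig_of_ne (hl : b ≠ l) (hq : b ≠ q) :
    ((Cmd.eig a h l q).exec S κ s).mem b = s.mem b :=
  (setBlock_of_ne hq).trans (setBlock_of_ne hl)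

lemma vec_exec_eig_of_ne (hl : b ≠ l) (hq : b ≠ q) :
    ((Cmd.eig a h l q).exec S κ s).vec b k = s.vec b k :=
  State.vec_congr (mem_exec_eig_of_ne hl hq)

lemma block_exec_eig_of_ne (hl : b ≠ l) (hq : b ≠ q) :
    ((Cmd.eig a h l q).exec S κ s).block b k = s.block b k :=
  State.block_congr (mem_exec_eig_of_ne hl hq)

end Eig

section Receive

variable {b n : ℕ} {g h : Vec n}

lemma vec_receive_three : (s.receive g h).vec 3 (n + 1) = g := by
  funext i
  simp only [State.vec, State.receive]
  rw [setBlock_of_ne (by decide), setBlock_same i.is_lt one_pos, dif_pos i.is_lt]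

lemma vec_receive_four : (s.receive g h).vec 4 (n + 1) = h := by
  funext i
  simp only [State.vec, State.receive]
  rw [setBlock_same i.is_lt one_pos, dif_pos i.is_lt]

lemma mem_receive_of_ne (h₃ : b ≠ 3) (h₄ : b ≠ 4) : (s.receive g h).mem b = s.mem b :=
  (setBlock_of_ne h₄).trans (setBlock_of_ne h₃)

end Receive

end Memory

/-! ### The program -/

section Evaluation

variable {S : Solver} {κ : ℕ} {s : State} {p q : RExpr} {r t : Cmd}

lemma exec_cond_of_le (h : p.eval s.mem s.ix ≤ q.eval s.mem s.ix) :
    (Cmd.cond p q r t).exec S κ s =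
      r.exec S κ ⟨s.mem, s.ix, s.steps + p.steps s.mem s.ix + q.steps s.mem s.ix + 1⟩ :=
  if_pos h

lemma exec_cond_of_lt (h : q.eval s.mem s.ix < p.eval s.mem s.ix) :
    (Cmd.cond p q r t).exec S κ s =
      t.exec S κ ⟨s.mem, s.ix, s.steps + p.steps s.mem s.ix + q.steps s.mem s.ix + 1⟩ :=
  if_neg h.not_ge

end Evaluation

/-- The frame `U` stored in a state. -/
abbrev State.frame (s : State) (n : ℕ) : Matrix (Fin (n + 1)) (Fin (n + 1)) ℝ :=
  s.block 2 (n + 1)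

/-- The squared widths `w` stored in a state. -/
abbrev State.widths (s : State) (n : ℕ) : Fin n → ℝ := s.vec 5 n

/- Arrays `0` and `1` hold the input and arrays `3` and `4` the answers of the oracle. Array `2`
holds the frame `U`, array `5` the squared widths `w`, array `6` the coordinates `δ̄`, array `7`
the vector `b`, arrays `8` and `9` the matrices `N` and `M`, and arrays `10`, `11` and `12`, `13`
their eigenvalues and eigenvectors. Index variables `2` and `3` are the row and the column of the
entry that is written, `4` and `5` are summation variables. -/

namespace Program

/-- The dimension `d`. -/
def dim : IExpr := .var 0

/-- The number `d - 1`. -/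
def codim : IExpr := .minus (.var 0) (.lit 1)

/-- Entry `i` of the vector stored in column `0` of array `a`. -/
def entry (a : ℕ) (i : IExpr) : RExpr := .get a i (.lit 0)

/-- A natural number as a real constant. -/
def const (k : ℕ) : RExpr := .cast (.lit k)

/-- Entry `i` of `f(x) - f(x⋆)`. -/
def diff (i : IExpr) : RExpr := .minus (entry 3 i) (entry 4 i)

/-- The entry of `δ̄` in the current row. -/
def coordsExpr : RExpr :=
  .sum 4 dim (.times (.get 2 (.var 4) (.var 2))
    (.over (diff (.var 4)) (.root (.sum 5 dim (.times (diff (.var 5)) (diff (.var 5)))))))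

/-- Entry `i` of `δ̄_[2:d]`. -/
def tailCoord (i : IExpr) : RExpr := entry 6 (.plus i (.lit 1))

/-- The squared width `δ̄_[2:d]' W δ̄_[2:d]`. -/
def widthExpr : RExpr :=
  .sum 4 codim (.times (tailCoord (.var 4)) (.times (entry 5 (.var 4)) (tailCoord (.var 4))))

/-- The number `ε = d / T`. -/
def epsExpr : RExpr := .over (.cast dim) (.cast (.var 1))

/-- The current entry of `W = diagonal w`; equality of indices is two comparisons. -/
def diagExpr : RExpr :=
  .cond (.cast (.var 2)) (.cast (.var 3))
    (.cond (.cast (.var 3)) (.cast (.var 2)) (entry 5 (.var 2)) (const 0)) (const 0)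

/-- The entry of `b` in the current row. -/
def bExpr : RExpr :=
  .times (.over (const 1) (.root widthExpr)) (.times (entry 5 (.var 2)) (tailCoord (.var 2)))

/-- The current entry of `N`. The test for `d = 2` reads `d ≤ 2`, since `N` has no entries if
`d = 1`. -/
def nExpr : RExpr :=
  .cond (.cast dim) (const 2) (.times (.over (const 1) (const 4)) diagExpr)
    (.times (.over (.times (.cast codim) (.cast codim))
        (.minus (.times (.cast codim) (.cast codim)) (const 1)))
      (.minus diagExpr (.times (.over (const 2) (.cast dim))
        (.times (entry 7 (.var 2)) (entry 7 (.var 3))))))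

/-- The entry of `a` that belongs to row or column `v` of `M`, where `v ≠ 0` is the value of an
index variable. -/
def aExpr (v : ℕ) : RExpr := .over (entry 7 (.minus (.var v) (.lit 1))) (.cast dim)

/-- The current entry of `M`. -/
def mExpr : RExpr :=
  .cond (.cast (.var 2)) (const 0)
    (.cond (.cast (.var 3)) (const 0) (const 1) (aExpr 3))
    (.cond (.cast (.var 3)) (const 0) (aExpr 2)
      (.minus (.times (aExpr 2) (aExpr 3))
        (.get 8 (.minus (.var 2) (.lit 1)) (.minus (.var 3) (.lit 1)))))

/-- The current entry of `U V`, where `V` is the eigenvector matrix of `M`. -/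
def frameExpr : RExpr := .sum 4 dim (.times (.get 2 (.var 2) (.var 4)) (.get 13 (.var 4) (.var 3)))

/-- The current entry of `± U V`, with the sign that makes the first entry of `± V` nonnegative. -/
def orientedFrameExpr : RExpr :=
  .cond (.get 13 (.lit 0) (.lit 0)) (const 0) (.minus (const 0) frameExpr) frameExpr

/-- `w := (tan α(C₀))²`, and `U :=` an orthogonal matrix with first column `c₀`. The latter is
obtained from the spectral decomposition of `c₀ c₀'`, whose leading eigenvector is `± c₀`. -/
def start : Cmd :=
  .seq (.fill 9 2 3 dim dim (.times (entry 0 (.var 2)) (entry 0 (.var 3)))) <|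
  .seq (.eig 9 dim 12 2) <|
  .seq (.fill 2 2 3 dim (.lit 1) (entry 0 (.var 2))) <|
  .fill 5 2 3 codim (.lit 1) (.times (entry 1 (.lit 0)) (entry 1 (.lit 0)))

/-- The computation of `b`, `N` and `M`. -/
def computeCut : Cmd :=
  .seq (.fill 7 2 3 codim (.lit 1) bExpr) <|
  .seq (.fill 8 2 3 codim codim nExpr) <|
  .fill 9 2 3 dim dim mExpr

/-- The update of the cone. The solver lists the eigenvalues of `N` in nonincreasing order, so they
are reversed. -/
def update : Cmd :=
  .seq computeCut <|
  .seq (.eig 8 codim 10 11) <|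
  .seq (.eig 9 dim 12 13) <|
  .seq (.fill 5 2 3 codim (.lit 1) (entry 10 (.minus codim (.plus (.var 2) (.lit 1))))) <|
  .fill 2 2 3 dim dim orientedFrameExpr

/-- The computation of `δ̄`. -/
def computeCoords : Cmd := .fill 6 2 3 dim (.lit 1) coordsExpr

/-- One period. -/
def step : Cmd := .seq computeCoords (.cond widthExpr (.times epsExpr epsExpr) .skip update)

/-- The algorithm `EllipsoidalCones` with `ε = d / T`. -/
def ellipsoidalCones : OnlineProgram := ⟨start, step⟩

lemma start_tame : start.Tame := by
  simp [start, Cmd.Tame, RExpr.Tame, dim, codim, entry, IExpr.eval, Nat.one_le_iff_ne_zero,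
    Nat.pos_iff_ne_zero]

lemma step_tame : step.Tame := by
  simp [step, computeCoords, update, computeCut, Cmd.Tame, RExpr.Tame, dim, codim, entry,
    IExpr.eval, coordsExpr, diff, widthExpr, tailCoord, epsExpr, bExpr, const, nExpr, diagExpr,
    mExpr, aExpr, frameExpr, orientedFrameExpr, Nat.one_le_iff_ne_zero, Nat.pos_iff_ne_zero]

/-! ### Values of the expressions -/

section Eval

variable {n : ℕ} {s : State} {ix : ℕ → ℕ} {w : Fin n → ℝ}
  {U : Matrix (Fin (n + 1)) (Fin (n + 1)) ℝ} {δ : Vec n}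

lemma update_update_zero (h₀ : ix 0 = n + 1) (i j : ℕ) :
    Function.update (Function.update ix 2 i) 3 j 0 = n + 1 := h₀

lemma eval_dim (h₀ : ix 0 = n + 1) : dim.eval ix = n + 1 := h₀

lemma eval_codim (h₀ : ix 0 = n + 1) : codim.eval ix = n := by
  simp only [codim, IExpr.eval, h₀, Nat.add_sub_cancel]

lemma eval_coordsExpr (h₀ : ix 0 = n + 1) {i : Fin (n + 1)} (h₂ : ix 2 = i) {g h : Vec n}
    (hg : s.vec 3 (n + 1) = g) (hh : s.vec 4 (n + 1) = h) :
    coordsExpr.eval s.mem ix = coords (s.frame n) (‖g - h‖⁻¹ • (g - h)) i := by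
  have hg' (k : Fin (n + 1)) : s.mem 3 k 0 = g k := congrFun hg k
  have hh' (k : Fin (n + 1)) : s.mem 4 k 0 = h k := congrFun hh k
  have hnorm : ‖g - h‖ = Real.sqrt (∑ k, (g k - h k) * (g k - h k)) := by
    simp only [EuclideanSpace.norm_eq, Real.norm_eq_abs, sq, abs_mul_abs_self, PiLp.sub_apply]
  simp [coordsExpr, diff, entry, RExpr.eval, IExpr.eval, dim, Function.update, h₀, h₂,
    Finset.sum_range, hg', hh', coords, hnorm, Matrix.mulVec, dotProduct, State.block,
    div_eq_inv_mul]

lemma eval_widthExpr (h₀ : ix 0 = n + 1) (hδ : s.vec 6 (n + 1) = coords U δ) :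
    widthExpr.eval s.mem ix = width (s.widths n) U δ := by
  have hδ' (i : Fin n) : s.mem 6 (i + 1) 0 = coords U δ i.succ := congrFun hδ i.succ
  simp [widthExpr, tailCoord, entry, RExpr.eval, IExpr.eval, eval_codim h₀, Finset.sum_range, hδ',
    State.vec, width, dotProduct, Matrix.mulVec_diagonal]

lemma eval_epsExpr (h₀ : ix 0 = n + 1) {T : ℕ} (h₁ : ix 1 = T) {mem : ℕ → ℕ → ℕ → ℝ} :
    epsExpr.eval mem ix = ((n + 1 : ℕ) : ℝ) / T := by
  simp only [epsExpr, RExpr.eval, eval_dim h₀, IExpr.eval, h₁]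

lemma eval_bExpr (h₀ : ix 0 = n + 1) {i : Fin n} (h₂ : ix 2 = i)
    (hδ : s.vec 6 (n + 1) = coords U δ) :
    bExpr.eval s.mem ix = updB (s.widths n) U δ i := by
  have hδ' : s.mem 6 (i + 1) 0 = coords U δ i.succ := congrFun hδ i.succ
  simp [bExpr, tailCoord, entry, const, RExpr.eval, IExpr.eval, eval_widthExpr h₀ hδ, h₂, hδ', updB,
    State.vec, Matrix.mulVec_diagonal]

lemma eval_diagExpr {i j : Fin n} (h₂ : ix 2 = i) (h₃ : ix 3 = j) :
    diagExpr.eval s.mem ix = Matrix.diagonal (s.widths n) i j := by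
  simp only [diagExpr, entry, const, RExpr.eval, IExpr.eval, h₂, h₃, Nat.cast_le, Nat.cast_zero,
    Fin.val_fin_le, Matrix.diagonal_apply, State.vec]
  rcases lt_trichotomy i j with h | h | h
  · rw [if_pos h.le, if_neg h.not_ge, if_neg h.ne]
  · rw [if_pos h.le, if_pos h.ge, if_pos h]
  · rw [if_neg h.not_ge, if_neg h.ne']

lemma eval_nExpr (h₀ : ix 0 = n + 1) {i j : Fin n} (h₂ : ix 2 = i) (h₃ : ix 3 = j)
    (hb : s.vec 7 n = updB (s.widths n) U δ) :
    nExpr.eval s.mem ix = updN (s.widths n) U δ i j := by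
  have hb' (k : Fin n) : s.mem 7 k 0 = updB (s.widths n) U δ k := congrFun hb k
  have hd : ((n + 1 : ℕ) : ℝ) ≤ ((2 : ℕ) : ℝ) ↔ n = 1 := by
    have := i.pos
    rw [Nat.cast_le]
    lia
  simp only [nExpr, RExpr.eval, eval_diagExpr h₂ h₃, const, entry, IExpr.eval, eval_dim h₀,
    eval_codim h₀, h₂, h₃, hb', hd, updN]
  split_ifs
  · simp
  · simp [sq, Matrix.vecMulVec_apply]

lemma eval_aExpr (h₀ : ix 0 = n + 1) {v : ℕ} {k : Fin n} (hv : ix v = k + 1)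
    (hb : s.vec 7 n = updB w U δ) : (aExpr v).eval s.mem ix = updA w U δ k := by
  have hb' : s.mem 7 k 0 = updB w U δ k := congrFun hb k
  simp [aExpr, entry, RExpr.eval, IExpr.eval, eval_dim h₀, hv, hb', updA, div_eq_inv_mul]

lemma eval_mExpr (h₀ : ix 0 = n + 1) {i j : Fin (n + 1)} (h₂ : ix 2 = i) (h₃ : ix 3 = j)
    (hb : s.vec 7 n = updB w U δ) (hN : s.block 8 n = updN w U δ) :
    mExpr.eval s.mem ix = updM w U δ i j := by
  have hpos (k : ℕ) : ¬ ((k + 1 : ℕ) : ℝ) ≤ 0 := not_le.2 (by positivity)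
  simp only [mExpr, RExpr.eval, IExpr.eval, const, Nat.cast_zero, Nat.cast_one, h₂, h₃]
  rcases Fin.eq_zero_or_eq_succ i with rfl | ⟨i, rfl⟩ <;>
    rcases Fin.eq_zero_or_eq_succ j with rfl | ⟨j, rfl⟩ <;>
    simp only [Fin.val_succ, Fin.val_zero, Nat.cast_zero, le_refl, if_true, hpos, if_false]
      at h₂ h₃ ⊢
  · rfl
  · exact eval_aExpr h₀ h₃ hb
  · exact eval_aExpr h₀ h₂ hb
  · rw [eval_aExpr h₀ h₂ hb, eval_aExpr h₀ h₃ hb, Nat.add_sub_cancel, Nat.add_sub_cancel]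
    exact congrArg _ (congrFun₂ hN i j)

lemma eval_orientedFrameExpr (h₀ : ix 0 = n + 1) {i j : Fin (n + 1)} (h₂ : ix 2 = i)
    (h₃ : ix 3 = j) {V : Matrix (Fin (n + 1)) (Fin (n + 1)) ℝ} (hV : s.block 13 (n + 1) = V) :
    orientedFrameExpr.eval s.mem ix = (s.frame n * if V 0 0 ≤ 0 then -V else V) i j := by
  have hUV : frameExpr.eval s.mem ix = (s.frame n * V) i j := by
    simp [frameExpr, RExpr.eval, IExpr.eval, eval_dim h₀, Function.update, h₂, h₃,
      Finset.sum_range, Matrix.mul_apply, State.block, ← hV]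
  have h₁₃ : s.mem 13 0 0 = V 0 0 := congrFun₂ hV 0 0
  simp only [orientedFrameExpr, const, RExpr.eval, IExpr.eval, Nat.cast_zero, h₁₃, hUV]
  split_ifs
  · rw [zero_sub, Matrix.mul_neg, Matrix.neg_apply]
  · rfl

end Eval

end Program

/-! ### Correctness of the program -/

section Orthogonal

variable {n : ℕ} {l : Fin (n + 1) → ℝ} {V : Matrix (Fin (n + 1)) (Fin (n + 1)) ℝ}
  {c : Fin (n + 1) → ℝ}

lemma updateCol_smul_col_mem_orthogonalGroup {ι : Type} [Fintype ι] [DecidableEq ι]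
    {V : Matrix ι ι ℝ} (hV : V ∈ Matrix.orthogonalGroup ι ℝ) (j : ι) {σ : ℝ} (hσ : σ ^ 2 = 1) :
    V.updateCol j (σ • V.col j) ∈ Matrix.orthogonalGroup ι ℝ := by
  have hdiag : Matrix.diagonal (Function.update 1 j σ) ∈ Matrix.orthogonalGroup ι ℝ := by
    rw [Matrix.mem_orthogonalGroup_iff, Matrix.diagonal_transpose, Matrix.diagonal_mul_diagonal,
      ← Matrix.diagonal_one]
    congr 1
    funext i
    rcases eq_or_ne i j with rfl | hij
    · rw [Function.update_self, ← sq, hσ]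
    · rw [Function.update_of_ne hij, Pi.one_apply, mul_one]
  have hmul : V.updateCol j (σ • V.col j) = V * Matrix.diagonal (Function.update 1 j σ) := by
    ext i k
    rw [Matrix.mul_diagonal]
    rcases eq_or_ne k j with rfl | hkj
    · rw [Matrix.updateCol_self, Function.update_self, Pi.smul_apply, Matrix.col_apply,
        smul_eq_mul, mul_comm]
    · rw [Matrix.updateCol_ne hkj, Function.update_of_ne hkj, Pi.one_apply, mul_one]
  exact hmul ▸ mul_mem hV hdiag

lemma exists_eq_smul_col_zero (hc : c ⬝ᵥ c = 1) (hl : Antitone l)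
    (h : IsSpectralDecomposition (Matrix.vecMulVec c c) l V) :
    ∃ σ : ℝ, σ ^ 2 = 1 ∧ c = σ • V.col 0 := by
  have hcc (v : Fin (n + 1) → ℝ) : Matrix.vecMulVec c c *ᵥ v = (c ⬝ᵥ v) • c := by
    rw [Matrix.vecMulVec_mulVec]
    ext i
    simp [mul_comm]
  set σ := c ⬝ᵥ V.col 0 with hσ
  have hcol : σ • c = l 0 • V.col 0 := (hcc _).symm.trans (h.mulVec_col 0)
  have hσl : σ ^ 2 = l 0 := by
    have := congrArg (V.col 0 ⬝ᵥ ·) hcol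
    simpa only [dotProduct_smul, smul_eq_mul, dotProduct_col_self h.1, mul_one,
      dotProduct_comm (V.col 0) c, ← hσ, ← sq] using this
  have hσl' : σ = l 0 * σ := by
    have := congrArg (c ⬝ᵥ ·) hcol
    simpa only [dotProduct_smul, smul_eq_mul, hc, mul_one, ← hσ] using this
  have hl₀ : 1 ≤ l 0 := by
    have := h.dotProduct_mulVec_le (c := l 0) (u := c) fun i hi => absurd (hl i.zero_le) hi.not_ge
    simpa only [hcc, dotProduct_smul, smul_eq_mul, hc, mul_one] using this
  have hl₁ : l 0 = 1 := by
    have hσ₀ : σ ≠ 0 := by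
      rintro h₀
      rw [h₀] at hσl
      linarith
    exact mul_right_cancel₀ hσ₀ (by linarith)
  refine ⟨σ, hσl.trans hl₁, ?_⟩
  rw [hl₁, one_smul] at hcol
  rw [← hcol, smul_smul, ← sq, hσl, hl₁, one_smul]

lemma updateCol_zero_mem_orthogonalGroup (hc : c ⬝ᵥ c = 1) (hl : Antitone l)
    (h : IsSpectralDecomposition (Matrix.vecMulVec c c) l V) :
    V.updateCol 0 c ∈ Matrix.orthogonalGroup (Fin (n + 1)) ℝ := by
  obtain ⟨σ, hσ, rfl⟩ := exists_eq_smul_col_zero hc hl h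
  exact updateCol_smul_col_mem_orthogonalGroup h.1 0 hσ

lemma blockMatrix_isSymm (a : Fin n → ℝ) {N : Matrix (Fin n) (Fin n) ℝ} (hN : N.IsSymm) :
    (blockMatrix a N).IsSymm := by
  refine Matrix.IsSymm.ext fun i j => ?_
  rcases Fin.eq_zero_or_eq_succ i with rfl | ⟨i, rfl⟩ <;>
    rcases Fin.eq_zero_or_eq_succ j with rfl | ⟨j, rfl⟩
  · rfl
  · rfl
  · rfl
  · change a j * a i - N j i = a i * a j - N i j
    rw [hN.apply, mul_comm]

lemma IsSpectralDecomposition.reindex {ι : Type} [Fintype ι] [DecidableEq ι] {A V : Matrix ι ι ℝ}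
    {l : ι → ℝ} (h : IsSpectralDecomposition A l V) (e : ι ≃ ι) :
    IsSpectralDecomposition A (l ∘ e) (V.submatrix id e) := by
  constructor
  · rw [Matrix.mem_orthogonalGroup_iff, Matrix.transpose_submatrix, Matrix.submatrix_mul_equiv,
      self_mul_transpose_of_orthogonal h.1, Matrix.submatrix_one _ Function.injective_id]
  · rw [← Matrix.submatrix_diagonal_equiv, Matrix.transpose_submatrix, Matrix.submatrix_mul_equiv,
      Matrix.submatrix_mul_equiv, Matrix.submatrix_id_id, ← h.2]

end Orthogonal

namespace Program

variable {S : Solver} {κ n : ℕ} {s : State} {δ : Vec n}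

section Start

variable {c₀ : Vec n} (h₀ : s.ix 0 = n + 1) (hc₀ : s.vec 0 (n + 1) = c₀)
include h₀

include hc₀ in
lemma frame_exec_start :
    (start.exec S κ s).frame n =
      (S (n + 1) (Matrix.vecMulVec c₀ c₀)).2.updateCol 0 (c₀ : Fin (n + 1) → ℝ) := by
  have hc₀' (i : Fin (n + 1)) : s.mem 0 i 0 = c₀ i := congrFun hc₀ i
  simp only [start, exec_seq]
  rw [State.frame, block_exec_fill_of_ne (by decide), block_exec_fill_col, block_exec_eig,
    block_exec_fill]
  any_goals exact eval_dim h₀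
  congr 1
  · congr 3
    exact Matrix.ext fun i j => congrArg₂ _ (hc₀' i) (hc₀' j)

lemma widths_exec_start {τ : ℝ} (hτ : s.mem 1 0 0 = τ) :
    (start.exec S κ s).widths n = fun _ => τ ^ 2 := by
  simp only [start, exec_seq]
  rw [State.widths, vec_exec_fill]
  · exact funext fun _ => hτ ▸ (sq _).symm
  · exact eval_codim h₀

end Start

section Update

variable (h₀ : s.ix 0 = n + 1) (hδ : s.vec 6 (n + 1) = coords (s.frame n) δ)
include h₀ hδ

lemma block_exec_computeCut :
    (computeCut.exec S κ s).block 8 n = updN (s.widths n) (s.frame n) δ ∧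
      (computeCut.exec S κ s).block 9 (n + 1) = updM (s.widths n) (s.frame n) δ := by
  simp only [computeCut, exec_seq]
  set s₁ := (Cmd.fill 7 2 3 codim (.lit 1) bExpr).exec S κ s
  have hb : s₁.vec 7 n = updB (s.widths n) (s.frame n) δ :=
    (vec_exec_fill (eval_codim h₀)).trans <|
      funext fun i => eval_bExpr (update_update_zero h₀ i 0) rfl hδ
  have hw : s₁.widths n = s.widths n := vec_exec_fill_of_ne (by decide)
  have h₁ : s₁.ix 0 = n + 1 := h₀
  set s₂ := (Cmd.fill 8 2 3 codim codim nExpr).exec S κ s₁ with hs₂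
  have hN : s₂.block 8 n = updN (s.widths n) (s.frame n) δ := by
    rw [← hw] at hb ⊢
    rw [hs₂, block_exec_fill (eval_codim h₁) (eval_codim h₁)]
    exact Matrix.ext fun i j => eval_nExpr (update_update_zero h₁ i j) rfl rfl hb
  have hb₂ : s₂.vec 7 n = updB (s.widths n) (s.frame n) δ :=
    (vec_exec_fill_of_ne (by decide)).trans hb
  have h₂ : s₂.ix 0 = n + 1 := h₀
  refine ⟨(block_exec_fill_of_ne (by decide)).trans hN, ?_⟩
  rw [block_exec_fill (eval_dim h₂) (eval_dim h₂)]
  exact Matrix.ext fun i j => eval_mExpr (update_update_zero h₂ i j) rfl rfl hb₂ hN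

lemma widths_exec_update :
    (update.exec S κ s).widths n =
      (S n (updN (s.widths n) (s.frame n) δ)).1 ∘ Fin.revPerm := by
  have hN := (block_exec_computeCut (S := S) (κ := κ) h₀ hδ).1
  have h₁ : (computeCut.exec S κ s).ix 0 = n + 1 := h₀
  simp only [update, exec_seq]
  generalize computeCut.exec S κ s = r at hN h₁ ⊢
  set r₁ := (Cmd.eig 8 codim 10 11).exec S κ r
  set r₂ := (Cmd.eig 9 dim 12 13).exec S κ r₁
  have hl : r₂.vec 10 n = (S n (updN (s.widths n) (s.frame n) δ)).1 := by
    rw [vec_exec_eig_of_ne (by decide) (by decide), vec_exec_eig (eval_codim h₁) (by decide), hN]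
  have h₂ : r₂.ix 0 = n + 1 := h₁
  rw [State.widths, vec_exec_fill_of_ne (by decide), vec_exec_fill (eval_codim h₂), ← hl]
  funext i
  simp [entry, RExpr.eval, IExpr.eval, State.vec, eval_codim, h₂, Fin.val_rev]

lemma frame_exec_update {V : Matrix (Fin (n + 1)) (Fin (n + 1)) ℝ}
    (hV : (S (n + 1) (updM (s.widths n) (s.frame n) δ)).2 = V) :
    (update.exec S κ s).frame n = s.frame n * if V 0 0 ≤ 0 then -V else V := by
  have hM := (block_exec_computeCut (S := S) (κ := κ) h₀ hδ).2
  have h₁ : (computeCut.exec S κ s).ix 0 = n + 1 := h₀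
  have hU : (computeCut.exec S κ s).block 2 (n + 1) = s.frame n := by
    simp only [computeCut, exec_seq]
    iterate 3 rw [block_exec_fill_of_ne (by decide)]
  simp only [update, exec_seq]
  generalize computeCut.exec S κ s = r at hM h₁ hU ⊢
  set r₁ := (Cmd.eig 8 codim 10 11).exec S κ r
  set r₂ := (Cmd.eig 9 dim 12 13).exec S κ r₁
  set r₃ := Cmd.exec S κ _ r₂ with hr₃
  have hU₃ : r₃.frame n = s.frame n := by
    rw [State.frame, block_exec_fill_of_ne (by decide),
      block_exec_eig_of_ne (by decide) (by decide), block_exec_eig_of_ne (by decide) (by decide),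
      hU]
  have hV₃ : r₃.block 13 (n + 1) = V := by
    rw [block_exec_fill_of_ne (by decide), block_exec_eig (eval_dim (ix := r₁.ix) h₁),
      block_exec_eig_of_ne (by decide) (by decide), hM, hV]
  have h₃ : r₃.ix 0 = n + 1 := h₁
  clear_value r₃
  rw [State.frame, block_exec_fill (eval_dim h₃) (eval_dim h₃), ← hU₃]
  exact Matrix.ext fun i j => eval_orientedFrameExpr (update_update_zero h₃ i j) rfl rfl hV₃

lemma coneUpdate_exec_update (hS : S.Correct) (hw : ∀ i, 0 ≤ s.widths n i) :
    ConeUpdate (s.widths n) (s.frame n) δ ((update.exec S κ s).widths n)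
      ((update.exec S κ s).frame n) := by
  have hN := updN_posSemidef (U := s.frame n) hw δ
  have hNsymm : (updN (s.widths n) (s.frame n) δ).IsSymm := by
    rw [Matrix.IsSymm, ← Matrix.conjTranspose_eq_transpose_of_trivial]
    exact hN.isHermitian
  obtain ⟨hμ, hQ⟩ := hS n _ hNsymm
  obtain ⟨hl, hV⟩ := hS (n + 1) (updM (s.widths n) (s.frame n) δ) (blockMatrix_isSymm _ hNsymm)
  have hne := eigenvector_zero_ne_zero hV hl hN
  rw [widths_exec_update h₀ hδ, frame_exec_update h₀ hδ rfl]
  refine ⟨⟨hμ.comp fun i j => Fin.rev_le_rev.2, _, hQ.reindex Fin.revPerm⟩, ?_⟩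
  split_ifs with hsign
  · exact ⟨_, _, hl, hV.neg, neg_pos.2 (hsign.lt_of_ne hne), rfl⟩
  · exact ⟨_, _, hl, hV, not_le.1 hsign, rfl⟩

end Update

section Step

variable {T : ℕ} (h₀ : s.ix 0 = n + 1) (h₁ : s.ix 1 = T) {g h : Vec n}

lemma mem_exec_computeCoords_receive {b : ℕ} (h₃ : b ≠ 3) (h₄ : b ≠ 4) (h₆ : b ≠ 6) :
    (computeCoords.exec S κ (s.receive g h)).mem b = s.mem b :=
  (setBlock_of_ne h₆).trans (mem_receive_of_ne h₃ h₄)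

lemma widths_exec_computeCoords_receive :
    (computeCoords.exec S κ (s.receive g h)).widths n = s.widths n :=
  State.vec_congr (mem_exec_computeCoords_receive (by decide) (by decide) (by decide))

lemma frame_exec_computeCoords_receive :
    (computeCoords.exec S κ (s.receive g h)).frame n = s.frame n :=
  State.block_congr (mem_exec_computeCoords_receive (by decide) (by decide) (by decide))

include h₀ in
lemma vec_exec_computeCoords_receive :
    (computeCoords.exec S κ (s.receive g h)).vec 6 (n + 1) =
      coords (s.frame n) (‖g - h‖⁻¹ • (g - h)) := by
  have hU : (s.receive g h).frame n = s.frame n :=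
    State.block_congr (mem_receive_of_ne (by decide) (by decide))
  rw [computeCoords, vec_exec_fill (s := s.receive g h) (eval_dim h₀), ← hU]
  exact funext fun i =>
    eval_coordsExpr (update_update_zero h₀ i 0) rfl vec_receive_three vec_receive_four

include h₀ h₁

lemma widthExpr_le_iff :
    let r := computeCoords.exec S κ (s.receive g h)
    widthExpr.eval r.mem r.ix ≤ (RExpr.times epsExpr epsExpr).eval r.mem r.ix ↔
      width (s.widths n) (s.frame n) (‖g - h‖⁻¹ • (g - h)) ≤ (((n + 1 : ℕ) : ℝ) / T) ^ 2 := by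
  intro r
  have hw : r.widths n = s.widths n := widths_exec_computeCoords_receive
  rw [eval_widthExpr (ix := r.ix) h₀ (vec_exec_computeCoords_receive h₀), hw, RExpr.eval,
    eval_epsExpr (ix := r.ix) h₀ h₁, sq]

lemma exec_step_receive_of_width_le
    (hle : width (s.widths n) (s.frame n) (‖g - h‖⁻¹ • (g - h)) ≤ (((n + 1 : ℕ) : ℝ) / T) ^ 2) :
    (step.exec S κ (s.receive g h)).widths n = s.widths n ∧
      (step.exec S κ (s.receive g h)).frame n = s.frame n := by
  have hw := widths_exec_computeCoords_receive (S := S) (κ := κ) (s := s) (g := g) (h := h)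
  have hU := frame_exec_computeCoords_receive (S := S) (κ := κ) (s := s) (g := g) (h := h)
  rw [step, exec_seq, exec_cond_of_le ((widthExpr_le_iff h₀ h₁).2 hle)]
  generalize computeCoords.exec S κ (s.receive g h) = r at hw hU ⊢
  exact ⟨hw, hU⟩

lemma coneUpdate_exec_step_receive (hS : S.Correct) (hw : ∀ i, 0 ≤ s.widths n i)
    (hlt : (((n + 1 : ℕ) : ℝ) / T) ^ 2 < width (s.widths n) (s.frame n) (‖g - h‖⁻¹ • (g - h))) :
    ConeUpdate (s.widths n) (s.frame n) (‖g - h‖⁻¹ • (g - h))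
      ((step.exec S κ (s.receive g h)).widths n) ((step.exec S κ (s.receive g h)).frame n) := by
  have hw' := widths_exec_computeCoords_receive (S := S) (κ := κ) (s := s) (g := g) (h := h)
  have hU' := frame_exec_computeCoords_receive (S := S) (κ := κ) (s := s) (g := g) (h := h)
  have hδ := vec_exec_computeCoords_receive (S := S) (κ := κ) h₀ (g := g) (h := h)
  have hr₀ : (computeCoords.exec S κ (s.receive g h)).ix 0 = n + 1 := h₀
  rw [step, exec_seq, exec_cond_of_lt (not_le.1 <| (widthExpr_le_iff h₀ h₁).not.2 hlt.not_ge)]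
  generalize computeCoords.exec S κ (s.receive g h) = r at hw' hU' hδ hr₀ ⊢
  generalize hs' : State.mk r.mem r.ix _ = s'
  have hw₁ : s'.widths n = s.widths n := hs' ▸ hw'
  have hU₁ : s'.frame n = s.frame n := hs' ▸ hU'
  rw [← hw₁] at hw
  simpa only [hw₁, hU₁] using coneUpdate_exec_update (κ := κ) (s := s') (hs' ▸ hr₀)
    (hs' ▸ hU' ▸ hδ) hS hw

end Step

end Program

section Run

variable {S : Solver} {κ n m T : ℕ} {C₀ : Set (Vec n)} {c₀ : Vec n} {τ : ℝ}

lemma vec_zero_inputState : (inputState n T c₀ τ).vec 0 (n + 1) = c₀ :=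
  funext fun i => by simp [State.vec, inputState, i.is_le]

lemma frame_exec_start_mem_orthogonalGroup (hS : S.Correct) (hc₀ : ‖c₀‖ = 1) :
    (Program.start.exec S κ (inputState n T c₀ τ)).frame n ∈
      Matrix.orthogonalGroup (Fin (n + 1)) ℝ := by
  have hcc : (c₀ : Fin (n + 1) → ℝ) ⬝ᵥ c₀ = 1 := by
    have := real_inner_self_eq_norm_sq c₀
    rwa [EuclideanSpace.inner_eq_star_dotProduct, star_trivial, hc₀, one_pow] at this
  obtain ⟨hl, hV⟩ := hS (n + 1) _ (Matrix.transpose_vecMulVec (c₀ : Fin (n + 1) → ℝ) c₀)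
  rw [Program.frame_exec_start rfl vec_zero_inputState]
  exact updateCol_zero_mem_orthogonalGroup hcc hl hV

lemma proxy_exec_start :
    (Program.start.exec S κ (inputState n T c₀ τ)).proxy n = c₀ := by
  have h := Program.frame_exec_start (S := S) (κ := κ) (s := inputState n T c₀ τ) rfl
    vec_zero_inputState
  ext i
  exact (congrFun₂ h i 0).trans (Matrix.updateCol_self ..)

variable {g h : ℕ → Vec n}

lemma run_invariants (hS : S.Correct) (hc₀ : ‖c₀‖ = 1) (t : ℕ) :
    (Program.ellipsoidalCones.run S κ T c₀ τ g h t).frame n ∈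
        Matrix.orthogonalGroup (Fin (n + 1)) ℝ ∧
      ∀ i, 0 ≤ (Program.ellipsoidalCones.run S κ T c₀ τ g h t).widths n i := by
  induction t with
  | zero =>
    refine ⟨frame_exec_start_mem_orthogonalGroup hS hc₀, fun i => ?_⟩
    rw [OnlineProgram.run, Program.ellipsoidalCones, Program.widths_exec_start rfl rfl]
    exact sq_nonneg τ
  | succ t ih =>
    have hix := Program.ellipsoidalCones.run_ix S κ T c₀ τ g h Program.start_tame
      Program.step_tame t
    have h₀ := congrFun hix 0
    have h₁ := congrFun hix 1
    rcases le_or_gt (width _ _ _) _ with hle | hlt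
    · obtain ⟨hw, hU⟩ := Program.exec_step_receive_of_width_le (S := S) (κ := κ) h₀ h₁ hle
      exact ⟨hU ▸ ih.1, hw ▸ ih.2⟩
    · have hupd := Program.coneUpdate_exec_step_receive (κ := κ) h₀ h₁ hS ih.2 hlt
      obtain ⟨Q, hQ⟩ := hupd.1.2
      exact ⟨hupd.orthogonal ih.1, hQ.nonneg (updN_posSemidef ih.2 _)⟩

theorem isRun_ellipsoidalCones (hS : S.Correct) (hc₀ : IsCircumcenter C₀ c₀)
    {X : ℕ → Set (EuclideanSpace ℝ (Fin m))} {f : ℕ → EuclideanSpace ℝ (Fin m) → Vec n}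
    {xstar x : ℕ → EuclideanSpace ℝ (Fin m)} {s : ℕ → State}
    (hs : s = Program.ellipsoidalCones.run S κ T c₀ (Real.tan (uncertaintyAngle C₀))
      (fun t => f t (x t)) fun t => f t (xstar t))
    (hx : ∀ t < T, x t ∈ argmins ((s t).proxy n) (X t) (f t)) :
    IsRun (((n + 1 : ℕ) : ℝ) / T) C₀ T X f xstar x (fun t => (s t).proxy n)
      (fun t => (s t).widths n) fun t => (s t).frame n := by
  subst hs
  have hinv := run_invariants (κ := κ) (T := T) (τ := Real.tan (uncertaintyAngle C₀))
    (g := fun t => f t (x t)) (h := fun t => f t (xstar t)) hS hc₀.1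
  have hix := Program.ellipsoidalCones.run_ix S κ T c₀ (Real.tan (uncertaintyAngle C₀))
    (fun t => f t (x t)) (fun t => f t (xstar t)) Program.start_tame Program.step_tame
  exact
    { start_orthogonal := (hinv 0).1
      start_axis := by
        rw [← proxy_exec_start (S := S) (κ := κ) (T := T) (c₀ := c₀)
          (τ := Real.tan (uncertaintyAngle C₀))] at hc₀
        exact hc₀
      start_width := fun i => congrFun (Program.widths_exec_start rfl rfl) i
      proxy := fun t _ => (isCircumcenter_ellipsoidalCone_iff (hinv t).1 (hinv t).2).2 rfl
      action := hx
      cone_update := fun t _ => Program.coneUpdate_exec_step_receive (congrFun (hix t) 0)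
        (congrFun (hix t) 1) hS (hinv t).2
      no_update := fun t _ => Program.exec_step_receive_of_width_le (congrFun (hix t) 0)
        (congrFun (hix t) 1) }

end Run

end ConeRegret

end

theorem mainTheorem2_general :
    (∀ (n m T : ℕ) (ε : ℝ) (C₀ : Set (ConeRegret.Vec n)) (cstar : ConeRegret.Vec n)
      (X : ℕ → Set (EuclideanSpace ℝ (Fin m)))
      (f : ℕ → EuclideanSpace ℝ (Fin m) → ConeRegret.Vec n)
      (xstar x : ℕ → EuclideanSpace ℝ (Fin m)) (c : ℕ → ConeRegret.Vec n) (w : ℕ → Fin n → ℝ)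
      (U : ℕ → Matrix (Fin (n + 1)) (Fin (n + 1)) ℝ),
      0 < ε → ConeRegret.uncertaintyAngle C₀ < Real.pi / 2 → cstar ∈ C₀ → ‖cstar‖ ≤ 1 →
      ConeRegret.Admissible T X f →
      (∀ t < T, xstar t ∈ ConeRegret.argmins cstar (X t) (f t)) →
      ConeRegret.IsRun ε C₀ T X f xstar x c w U →
      ConeRegret.regret T cstar f x xstar ≤
        2 * (n : ℝ) ^ 2 *
          max 0 (Real.log (2 * n * Real.tan (ConeRegret.uncertaintyAngle C₀) / ε))
        + T * ε) ∧
    (∃ p : ConeRegret.OnlineProgram, ∀ κ : ℕ, ∃ P : MvPolynomial (Fin 2) ℕ,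
      ∀ (S : ConeRegret.Solver) (n m T : ℕ) (C₀ : Set (ConeRegret.Vec n))
      (c₀ : ConeRegret.Vec n) (X : ℕ → Set (EuclideanSpace ℝ (Fin m)))
      (f : ℕ → EuclideanSpace ℝ (Fin m) → ConeRegret.Vec n)
      (xstar x : ℕ → EuclideanSpace ℝ (Fin m)) (s : ℕ → ConeRegret.State),
      S.Correct → 1 ≤ T → C₀.Nonempty → ConeRegret.uncertaintyAngle C₀ < Real.pi / 2 →
      ConeRegret.IsCircumcenter C₀ c₀ →
      s = p.run S κ T c₀ (Real.tan (ConeRegret.uncertaintyAngle C₀))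
        (fun t => f t (x t)) (fun t => f t (xstar t)) →
      (∀ t < T, x t ∈ ConeRegret.argmins ((s t).proxy n) (X t) (f t)) →
      (∃ (w : ℕ → Fin n → ℝ) (U : ℕ → Matrix (Fin (n + 1)) (Fin (n + 1)) ℝ),
        ConeRegret.IsRun (((n + 1 : ℕ) : ℝ) / (T : ℝ)) C₀ T X f xstar x
          (fun t => (s t).proxy n) w U) ∧
      (s T).steps ≤ MvPolynomial.eval ![n + 1, T] P) := by
  refine ⟨?regret, ConeRegret.Program.ellipsoidalCones, fun κ =>
    ⟨ConeRegret.Program.ellipsoidalCones.cost κ, ?program⟩⟩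
  case regret =>
    intro n m T ε C₀ cstar X f xstar x c w U hε hα hcs hcn hX hstar hrun
    exact hrun.regret_le hε hα hX hcs hcn hstar
  case program =>
    intro S n m T C₀ c₀ X f xstar x s hS _ _ _ hc₀ hs hx
    refine ⟨⟨_, _, ConeRegret.isRun_ellipsoidalCones hS hc₀ hs hx⟩, ?_⟩
    rw [hs]
    exact ConeRegret.OnlineProgram.run_steps_le _ _ _ _ _ _ _ _
      ConeRegret.Program.start_tame ConeRegret.Program.step_tame

theorem mainTheorem2 :
    -- regret of every run of the algorithm
    (∀ (n m T : ℕ) (C₀ : Set (ConeRegret.Vec n)) (cstar : ConeRegret.Vec n)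
      (X : ℕ → Set (EuclideanSpace ℝ (Fin m)))
      (f : ℕ → EuclideanSpace ℝ (Fin m) → ConeRegret.Vec n)
      (xstar x : ℕ → EuclideanSpace ℝ (Fin m)) (c : ℕ → ConeRegret.Vec n) (w : ℕ → Fin n → ℝ)
      (U : ℕ → Matrix (Fin (n + 1)) (Fin (n + 1)) ℝ),
      1 ≤ T → C₀ ⊆ Metric.sphere 0 1 → ConeRegret.uncertaintyAngle C₀ < Real.pi / 2 →
      cstar ∈ C₀ → ConeRegret.Admissible T X f →
      (∀ t < T, xstar t ∈ ConeRegret.argmins cstar (X t) (f t)) →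
      ConeRegret.IsRun (((n + 1 : ℕ) : ℝ) / (T : ℝ)) C₀ T X f xstar x c w U →
      ConeRegret.regret T cstar f x xstar ≤
        2 * (n : ℝ) ^ 2 *
          max 0 (Real.log (10 * (T : ℝ) * Real.tan (ConeRegret.uncertaintyAngle C₀)))
        + ((n + 1 : ℕ) : ℝ)) ∧
    -- one program, for all dimensions and horizons, carries out the algorithm in polynomial time
    (∃ p : ConeRegret.OnlineProgram, ∀ κ : ℕ, ∃ P : MvPolynomial (Fin 2) ℕ,
      ∀ (S : ConeRegret.Solver) (n m T : ℕ) (C₀ : Set (ConeRegret.Vec n))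
      (c₀ cstar : ConeRegret.Vec n) (X : ℕ → Set (EuclideanSpace ℝ (Fin m)))
      (f : ℕ → EuclideanSpace ℝ (Fin m) → ConeRegret.Vec n)
      (xstar x : ℕ → EuclideanSpace ℝ (Fin m)) (s : ℕ → ConeRegret.State),
      S.Correct → 1 ≤ T → C₀ ⊆ Metric.sphere 0 1 →
      ConeRegret.uncertaintyAngle C₀ < Real.pi / 2 → ConeRegret.IsCircumcenter C₀ c₀ →
      cstar ∈ C₀ → ConeRegret.Admissible T X f →
      (∀ t < T, xstar t ∈ ConeRegret.argmins cstar (X t) (f t)) →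
      s = p.run S κ T c₀ (Real.tan (ConeRegret.uncertaintyAngle C₀))
        (fun t => f t (x t)) (fun t => f t (xstar t)) →
      (∀ t < T, x t ∈ ConeRegret.argmins ((s t).proxy n) (X t) (f t)) →
      (∃ (w : ℕ → Fin n → ℝ) (U : ℕ → Matrix (Fin (n + 1)) (Fin (n + 1)) ℝ),
        ConeRegret.IsRun (((n + 1 : ℕ) : ℝ) / (T : ℝ)) C₀ T X f xstar x
          (fun t => (s t).proxy n) w U) ∧
      (s T).steps ≤ MvPolynomial.eval ![n + 1, T] P) := by
  refine ⟨fun n m T C₀ cstar X f xstar x c w U hT hC hα hcs hX hstar hrun => ?_, ?_⟩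
  · exact (mainTheorem2_general.1 n m T _ C₀ cstar X f xstar x c w U (by positivity) hα hcs
      (mem_sphere_zero_iff_norm.1 (hC hcs)).le hX hstar hrun).trans
      (ConeRegret.regretBound_le hT (ConeRegret.tan_uncertaintyAngle_nonneg hα))
  · exact mainTheorem2_general.2.imp fun p hp κ => (hp κ).imp fun P hP S n m T C₀ c₀ cstar X f
      xstar x s hS hT _ hα hc₀ hcs _ _ => hP S n m T C₀ c₀ X f xstar x s hS hT ⟨cstar, hcs⟩ hα hc₀
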